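/- Let $F$ be a field of characteristic $p\ge 0$, let $n\ge 1$ and let $U_1,\dots,U_n$ be finite sets with $|U_h|>1$. Let $S$ be the factorial scheme of $U_1,\dots,U_n$, that is, the direct product of the trivial association schemes on the $U_h$: the point set is $X=\prod_h U_h$, the relations are labelled by $E=\{0,1\}^n$, and $(x,y)\in R_g$ iff for every $h$ one has $x_h=y_h$ when $g_h=0$ and $x_h\ne y_h$ when $g_h=1$. Let $k_g=|\{y:(x,y)\in R_g\}|$ (independent of $x$) be the valencies; $S$ is $p'$-valenced if $p\nmid k_g$ for all $g\in E$. Fix $x\in X$. Let $A_g$ be the adjacency $F$-matrix of $R_g$, let $E_g^*$ be the diagonal $\{0,1\}$-matrix whose $(y,y)$-entry is $1$ iff $(x,y)\in R_g$, and let $T$ be the Terwilliger $F$-algebra of $S$ with respect to $x$, i.e. the $F$-subalgebra of $M_X(F)$ generated by all $A_g$ and $E_g^*$ $(g\in E)$. Write $\mathbf 1=(1,\dots,1)\in E$. An $F$-algebra is semisimple if it is isomorphic to a direct sum of finitely many (at least one) full matrix algebras of positive sizes over finite-dimensional division $F$-algebras. A linear functional $\alpha$ of a finite-dimensional $F$-algebra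 $A$ is nonsingular if for every $f\in A$ the conditions $\alpha(Af)=0$, $\alpha(fA)=0$ and $f=0$ are equivalent; $A$ is a Frobenius $F$-algebra if it has a nonsingular functional, and a symmetric $F$-algebra if it has a nonsingular functional $\alpha$ with $\alpha(fg)=\alpha(gf)$ for all $f,g\in A$. Identify $g\in E$ with the set $\{a: g_a=1\}\subseteq\{1,\dots,n\}$, and for $V\subseteq\{1,\dots,n\}$ let $V^\circ=\{a\in V:|U_a|>2\}$. Let $D$ be the set of triples $(a,b,c)\in E^3$ such that $a\triangle c\subseteq b\subseteq (a\triangle c)\cup(a\cap c)^\circ$ and $p\nmid k_b$. Write $(g,h,i)\sim(j,k,l)$ for $(g,h,i),(j,k,l)\in D$ if $(g\cap i)^\circ\setminus h=(j\cap l)^\circ\setminus k$; let $D_1,\dots,D_{n_\sim}$ be the equivalence classes of $\sim$, and let $D(m)=\{a\in E: (a,b,a)\in D_m\text{ for some } b\in E\}$. Then the following eight conditions are equivalent: 1. $S$ is $p'$-valenced; 2. $T$ is a semisimple $F$-algebra; 3. $E_g^*TE_g^*$ (with identity $E_g^*$) is a semisimple $F$-algebra for every $g\in E$; 4. $E_{\mathbf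 1}^*TE_{\mathbf 1}^*$ is a semisimple $F$-algebra; 5. the center $Z(T)$ is a semisimple $F$-algebra; 6. $T$ is a symmetric $F$-algebra; 7. $T$ is a Frobenius $F$-algebra; 8. $T\cong\bigoplus_{m=1}^{n_\sim}M_{|D(m)|}(F)$ as $F$-algebras. In particular, each of these conditions holds if and only if $p\nmid\prod_{h=1}^n(|U_h|-1)$. -/

import Mathlib

universe u v w

/-! ### Association schemes -/

/-- An association scheme on a finite set `X` with relations labelled by `E`.
The partition `{R_a : a ∈ E}` of `X × X` is recorded by the surjective map `rel` sending `(x, y)`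
to the label of the class containing it, so that `(x, y) ∈ R_a` means `rel x y = a`.
The label `zero` of the diagonal, the transposition `star` of labels and the intersection numbers
`p g h i` (usually written `p_{g,h}^i`) are determined by `rel`. -/
structure AssocScheme (X : Type u) (E : Type v) [Fintype X] [DecidableEq E] where
  rel : X → X → E
  rel_surj : ∀ a : E, ∃ x y : X, rel x y = a
  zero : E
  rel_eq_zero : ∀ x y : X, rel x y = zero ↔ x = y
  star : E → E
  rel_star : ∀ (g : E) (x y : X), rel x y = star g ↔ rel y x = g
  p : E → E → E → ℕ
  card_inter : ∀ (g h : E) (x y : X),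
    (Finset.univ.filter fun a : X => rel x a = g ∧ rel a y = h).card = p g h (rel x y)

namespace AssocScheme

/-- The valency `k_g = p_{g, g*}^0`. -/
def valency {X : Type u} {E : Type v} [Fintype X] [DecidableEq E] (S : AssocScheme X E)
    (g : E) : ℕ := S.p g (S.star g) S.zero

/-- `S` is `q'`-valenced if `q` divides no valency of `S`. -/
def IsPrimeValenced {X : Type u} {E : Type v} [Fintype X] [DecidableEq E] (S : AssocScheme X E)
    (q : ℕ) : Prop := ∀ g : E, ¬ q ∣ S.valency g

/-- The trivial scheme on a set `U` with more than one element: `R_0` is the diagonal and `R_1`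
is its complement. -/
def trivialScheme (U : Type u) [Fintype U] [DecidableEq U] [Nontrivial U] :
    AssocScheme U (Fin 2) where
  rel x y := if x = y then 0 else 1
  rel_surj a := by
    obtain ⟨x, y, hxy⟩ := exists_pair_ne U
    fin_cases a
    · exact ⟨x, x, by simp⟩
    · exact ⟨x, y, by simp [hxy]⟩
  zero := 0
  rel_eq_zero x y := by by_cases h : x = y <;> simp [h]
  star g := g
  rel_star g x y := by simp only [eq_comm (a := x)]
  p i j k :=
    if i = 0 then (if j = k then 1 else 0)
    else if j = 0 then (if i = k then 1 else 0)
    else if k = 0 then Fintype.card U - 1 else Fintype.card U - 2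
  card_inter g h x y := by
    have e0 : ∀ a b : U, ((if a = b then 0 else 1 : Fin 2) = 0) ↔ a = b := by
      intro a b; by_cases hab : a = b <;> simp [hab]
    have e1 : ∀ a b : U, ((if a = b then 0 else 1 : Fin 2) = 1) ↔ a ≠ b := by
      intro a b; by_cases hab : a = b <;> simp [hab]
    have hg : g = 0 ∨ g = 1 := by omega
    have hh : h = 0 ∨ h = 1 := by omega
    rcases hg with rfl | rfl
    · have : (Finset.univ.filter fun a : U => (if x = a then 0 else 1 : Fin 2) = 0 ∧
          (if a = y then 0 else 1 : Fin 2) = h)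
          = if h = (if x = y then 0 else 1 : Fin 2) then {x} else ∅ := by
        ext a
        simp only [e0, Finset.mem_filter, Finset.mem_univ, true_and]
        constructor
        · rintro ⟨rfl, rfl⟩; simp
        · intro ha
          split_ifs at ha with h1 h2 h3
          all_goals simp_all
      rw [this]
      simp only [if_true]
      split_ifs <;> simp
    · rcases hh with rfl | rfl
      · have : (Finset.univ.filter fun a : U => (if x = a then 0 else 1 : Fin 2) = 1 ∧
            (if a = y then 0 else 1 : Fin 2) = 0) = if x = y then ∅ else {y} := by
          ext a
          simp only [e0, e1, Finset.mem_filter, Finset.mem_univ, true_and]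
          constructor
          · rintro ⟨h1, rfl⟩; simp [h1]
          · intro ha
            split_ifs at ha with h1
            all_goals simp_all
        rw [this]
        by_cases hxy : x = y <;> simp [hxy]
      · have : (Finset.univ.filter fun a : U => (if x = a then 0 else 1 : Fin 2) = 1 ∧
            (if a = y then 0 else 1 : Fin 2) = 1) = Finset.univ \ {x, y} := by
          ext a
          simp only [e1, Finset.mem_filter, Finset.mem_univ, true_and, Finset.mem_sdiff,
            Finset.mem_insert, Finset.mem_singleton, not_or]
          exact ⟨fun h => ⟨fun h' => h.1 h'.symm, h.2⟩, fun h => ⟨fun h' => h.1 h'.symm, h.2⟩⟩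
        rw [this, Finset.card_univ_sdiff]
        by_cases hxy : x = y
        · simp [hxy]
        · rw [Finset.card_pair hxy]; simp [hxy]

/-- The direct product of finitely many schemes: two tuples are in relation `i` if they are
componentwise in the relations `i h`. -/
def directProduct {n : ℕ} {X : Fin n → Type u} {E : Fin n → Type v}
    [∀ h, Fintype (X h)] [∀ h, DecidableEq (E h)] (S : ∀ h, AssocScheme (X h) (E h)) :
    AssocScheme (∀ h, X h) (∀ h, E h) where
  rel x y := fun h => (S h).rel (x h) (y h)
  rel_surj a := by
    choose x y hxy using fun h => (S h).rel_surj (a h)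
    exact ⟨x, y, funext hxy⟩
  zero := fun h => (S h).zero
  rel_eq_zero x y := by simp only [funext_iff, rel_eq_zero]
  star g := fun h => (S h).star (g h)
  rel_star g x y := by simp only [funext_iff, rel_star]
  p i j k := ∏ h, (S h).p (i h) (j h) (k h)
  card_inter g h x y := by
    classical
    have : (Finset.univ.filter fun a : ∀ h, X h =>
        (fun i => (S i).rel (x i) (a i)) = g ∧ (fun i => (S i).rel (a i) (y i)) = h)
        = Fintype.piFinset fun i => Finset.univ.filter fun a : X i =>
            (S i).rel (x i) a = g i ∧ (S i).rel a (y i) = h i := by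
      ext a
      simp only [Finset.mem_filter, Finset.mem_univ, true_and, Fintype.mem_piFinset, funext_iff,
        forall_and]
    rw [this, Fintype.card_piFinset]
    exact Finset.prod_congr rfl fun i _ => (S i).card_inter (g i) (h i) (x i) (y i)

/-- The factorial scheme of a sequence of sets: the direct product of their trivial schemes. -/
def factorialScheme {n : ℕ} (U : Fin n → Type u) [∀ h, Fintype (U h)] [∀ h, DecidableEq (U h)]
    [∀ h, Nontrivial (U h)] : AssocScheme (∀ h, U h) (Fin n → Fin 2) :=
  directProduct fun h => trivialScheme (U h)

/-! ### The Terwilliger algebra -/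

section Terwilliger

/-- The adjacency matrix `A_g`. -/
def adjMatrix (F : Type w) [Field F] {X : Type u} {E : Type v} [Fintype X] [DecidableEq E]
    (S : AssocScheme X E) (g : E) : Matrix X X F :=
  Matrix.of fun x y => if S.rel x y = g then 1 else 0

/-- The dual idempotent `E_g^*(x)`. -/
def dualIdem (F : Type w) [Field F] {X : Type u} {E : Type v} [Fintype X] [DecidableEq X]
    [DecidableEq E] (S : AssocScheme X E) (x : X) (g : E) : Matrix X X F :=
  Matrix.diagonal fun y => if S.rel x y = g then 1 else 0

/-- The Terwilliger `F`-algebra `T(x)` of `S` with respect to `x`. -/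
def terwilliger (F : Type w) [Field F] {X : Type u} {E : Type v} [Fintype X] [DecidableEq X]
    [DecidableEq E] (S : AssocScheme X E) (x : X) : Subalgebra F (Matrix X X F) :=
  Algebra.adjoin F (Set.range (S.adjMatrix F) ∪ Set.range (S.dualIdem F x))

/-- The dual idempotent `E_g^*(x)` as an element of `T(x)`. -/
def dualIdemT (F : Type w) [Field F] {X : Type u} {E : Type v} [Fintype X] [DecidableEq X]
    [DecidableEq E] (S : AssocScheme X E) (x : X) (g : E) : S.terwilliger F x :=
  ⟨S.dualIdem F x g, Algebra.subset_adjoin (Or.inr ⟨g, rfl⟩)⟩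

theorem isIdempotentElem_dualIdemT (F : Type w) [Field F] {X : Type u} {E : Type v} [Fintype X]
    [DecidableEq X] [DecidableEq E] (S : AssocScheme X E) (x : X) (g : E) :
    IsIdempotentElem (S.dualIdemT F x g) := by
  apply Subtype.ext
  change S.dualIdem F x g * S.dualIdem F x g = S.dualIdem F x g
  simp only [dualIdem, Matrix.diagonal_mul_diagonal]
  congr 1
  funext y
  split_ifs <;> simp

end Terwilliger

end AssocScheme

/-! ### Finite-dimensional algebras -/

/-- The corner `eAe = {e * a * e : a ∈ A}` of an idempotent `e` of an `F`-algebra `A`, a ring with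
identity element `e`, is an `F`-algebra with the scalar multiplication of `A`. -/
instance cornerAlgebra {F : Type u} {A : Type v} [Field F] [Ring A] [Algebra F A] {e : A}
    (he : IsIdempotentElem e) : Algebra F he.Corner where
  smul r a := ⟨r • a.1, by
    obtain ⟨b, hb⟩ := a.2
    exact ⟨r • b, by simp only [← hb, mul_smul_comm, smul_mul_assoc]⟩⟩
  algebraMap :=
    { toFun := fun r => ⟨r • e, r • e, by
        simp only [mul_smul_comm, smul_mul_assoc, he.eq]⟩
      map_one' := Subtype.ext (one_smul F e)
      map_mul' := fun r s => Subtype.ext (by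
        change (r * s) • e = (r • e) * (s • e)
        rw [smul_mul_smul_comm, he.eq])
      map_zero' := Subtype.ext (zero_smul F e)
      map_add' := fun r s => Subtype.ext (add_smul r s e) }
  commutes' r a := Subtype.ext (by
    change (r • e) * a.1 = a.1 * (r • e)
    have h := (Subsemigroup.mem_corner_iff he).mp a.2
    rw [smul_mul_assoc, mul_smul_comm, h.1, h.2])
  smul_def' r a := Subtype.ext (by
    change r • a.1 = (r • e) * a.1
    rw [smul_mul_assoc, ((Subsemigroup.mem_corner_iff he).mp a.2).1])

/-- `A` is a semisimple `F`-algebra: it is isomorphic to the direct sum of a positive finite number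
of full matrix algebras of positive size over finite-dimensional division `F`-algebras. -/
def IsSemisimpleAlg (F : Type u) (A : Type v) [Field F] [Ring A] [Algebra F A] : Prop :=
  ∃ (r : ℕ) (K : Fin r → Type v) (m : Fin r → ℕ) (_ : ∀ i, DivisionRing (K i))
    (_ : ∀ i, Algebra F (K i)), 0 < r ∧ (∀ i, 0 < m i) ∧ (∀ i, FiniteDimensional F (K i)) ∧
    Nonempty (A ≃ₐ[F] ∀ i, Matrix (Fin (m i)) (Fin (m i)) (K i))

/-- A linear functional `α` of `A` is nonsingular if the conditions `α(Af) = 0`, `α(fA) = 0` and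
`f = 0` are equivalent for every `f` in `A`. -/
def IsNonsingularFunctional {F : Type u} {A : Type v} [Field F] [Ring A] [Algebra F A]
    (α : A →ₗ[F] F) : Prop :=
  ∀ f : A, ((∀ a, α (a * f) = 0) ↔ f = 0) ∧ ((∀ a, α (f * a) = 0) ↔ f = 0)

/-- A Frobenius `F`-algebra has a nonsingular linear functional. -/
def IsFrobeniusAlg (F : Type u) (A : Type v) [Field F] [Ring A] [Algebra F A] : Prop :=
  ∃ α : A →ₗ[F] F, IsNonsingularFunctional α

/-- A symmetric `F`-algebra has a nonsingular linear functional `α` with `α(fg) = α(gf)`. -/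
def IsSymmetricAlg (F : Type u) (A : Type v) [Field F] [Ring A] [Algebra F A] : Prop :=
  ∃ α : A →ₗ[F] F, IsNonsingularFunctional α ∧ ∀ f g : A, α (f * g) = α (g * f)

/-! ### The index sets of the Wedderburn decomposition -/

namespace FactorialScheme

/-- The set `{a : g_a = 1}` attached to a tuple `g` with entries in `{0, 1}`. -/
def supp {n : ℕ} (g : Fin n → Fin 2) : Finset (Fin n) := Finset.univ.filter fun a => g a = 1

/-- `V° = {a ∈ V : |U_a| > 2}`. -/
def big {n : ℕ} (U : Fin n → Type u) [∀ h, Fintype (U h)] (V : Finset (Fin n)) :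
    Finset (Fin n) := V.filter fun a => 2 < Fintype.card (U a)

/-- The set of triples `(a, b, c)` with `a △ c ⊆ b ⊆ (a △ c) ∪ (a ∩ c)°`, where tuples are
identified with the sets attached to them. -/
def setP {n : ℕ} (U : Fin n → Type u) [∀ h, Fintype (U h)] :
    Set ((Fin n → Fin 2) × (Fin n → Fin 2) × (Fin n → Fin 2)) :=
  {t | symmDiff (supp t.1) (supp t.2.2) ⊆ supp t.2.1 ∧
    supp t.2.1 ⊆ symmDiff (supp t.1) (supp t.2.2) ∪ big U (supp t.1 ∩ supp t.2.2)}

/-- The set `D` of triples `(a, b, c)` in `P` such that `p` does not divide `k_b`. -/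
def setD {n : ℕ} (U : Fin n → Type u) [∀ h, Fintype (U h)] [∀ h, DecidableEq (U h)]
    [∀ h, Nontrivial (U h)] (p : ℕ) :
    Set ((Fin n → Fin 2) × (Fin n → Fin 2) × (Fin n → Fin 2)) :=
  {t | t ∈ setP U ∧ ¬ p ∣ (AssocScheme.factorialScheme U).valency t.2.1}

/-- The equivalence relation on `D` given by `(g, h, i) ∼ (j, k, l)` if and only if
`(g ∩ i)° \ h = (j ∩ l)° \ k`. -/
def relD {n : ℕ} (U : Fin n → Type u) [∀ h, Fintype (U h)] [∀ h, DecidableEq (U h)]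
    [∀ h, Nontrivial (U h)] (p : ℕ) : Setoid (setD U p) :=
  Setoid.comap (fun t : setD U p =>
    big U (supp t.1.1 ∩ supp t.1.2.2) \ supp t.1.2.1) ⊥

/-- The set `D(m) = {a : (a, b, a) ∈ D_m for some b}` of an equivalence class `D_m` of `D`. -/
def classD {n : ℕ} (U : Fin n → Type u) [∀ h, Fintype (U h)] [∀ h, DecidableEq (U h)]
    [∀ h, Nontrivial (U h)] (p : ℕ) (m : Quotient (relD U p)) : Set (Fin n → Fin 2) :=
  {a | ∃ (b : Fin n → Fin 2) (h : (a, b, a) ∈ setD U p), (Quotient.mk _ ⟨(a, b, a), h⟩) = m}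

end FactorialScheme

/-!
The Terwilliger algebra `T` of a factorial scheme is the tensor product of the Terwilliger algebras
`T_h` of the trivial schemes on the `U_h`. With `J` the all-ones matrix, `T_h` is spanned by the four
blocks `E_i^* J E_j^*` and by `E_1^*`, and everything is governed by whether
`k = |U_h| - 1` vanishes in `F`, since `(E_1^* J E_1^*)² = k E_1^* J E_1^*`. All conditions are
compared with the nonvanishing of `|U_h| - 1` in `F` for every `h`.

If no `|U_h| - 1` vanishes, the four blocks can be rescaled to the matrix units of `M_2(F)`, and
`E_1^* - k⁻¹ E_1^* J E_1^*` is a complementary idempotent, which is zero exactly when `|U_h| = 2`.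
Kronecker products of these elements are matrix units of `T`: the set `W` of coordinates at which
the complementary idempotent is chosen labels the block, and the rows of the block are the tuples
containing `W`. These labels are the sets `(g ∩ i)° \ h`, so this is the decomposition
`T ≅ ⨁ M_{|D(m)|}(F)` of `AssocScheme.nonempty_terwilliger_algEquiv`. A product of matrix algebras
is symmetric by its traces and semisimple, and semisimplicity passes to corners and to the center
because a finite-dimensional nonzero algebra is semisimple as soon as `z A z = 0` forces `z = 0`
(`isSemisimpleAlg_of_semiprime`).

If some `|U_h| - 1` vanishes, then `E_1^* J E_1^*` at the coordinate `h` is a central element of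
square zero (`AssocScheme.exists_central_sq_zero`), which rules out the semisimplicity of `T`, of its
center and of the corner of the all-ones tuple. For the Frobenius property, let `R` consist of the
elements of `T` that act trivially on the coordinate `h`. The elements `c = E_1^* J E_0^*` and
`d = E_1^* J E_1^*` at that coordinate generate a left ideal `cR ⊕ dR` on which `T` acts through
`R`. A nonsingular functional would therefore embed `R × R` into the dual space of `R`, contrary to
the dimensions (`not_isFrobeniusAlg_of_free_pair`).
-/

/-! ### Semisimple and symmetric algebras -/

/-- In a semisimple algebra, an element `z` with `z A z = 0` vanishes. -/
theorem IsSemisimpleAlg.eq_zero_of_mul_mul_self {F : Type u} {A : Type v} [Field F] [Ring A]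
    [Algebra F A] (h : IsSemisimpleAlg F A) {z : A} (hz : ∀ a, z * a * z = 0) : z = 0 := by
  obtain ⟨r, K, m, _, _, -, -, -, ⟨φ⟩⟩ := h
  apply φ.injective
  rw [map_zero]
  funext i
  ext j k
  have h1 := congrArg φ (hz (φ.symm (Pi.single i (Matrix.single k j 1))))
  simp only [map_mul, AlgEquiv.apply_symm_apply, map_zero] at h1
  have h2 := congrFun (congrFun (congrFun h1 i) j) k
  simp only [Pi.mul_apply, Pi.single_eq_same, Pi.zero_apply, Matrix.zero_apply] at h2
  rw [Matrix.mul_assoc, Matrix.mul_apply, Finset.sum_eq_single k] at h2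
  · simpa using h2
  · intro b _ hb
    simp [Matrix.single_mul_apply_of_ne, hb]
  · simp

/-- A nonzero finite-dimensional algebra in which `z A z = 0` forces `z = 0` is semisimple: its
Jacobson radical is nilpotent, and the last nonzero power of the radical would consist of such
elements `z`. -/
theorem isSemisimpleAlg_of_semiprime {F : Type u} {A : Type v} [Field F] [Ring A] [Algebra F A]
    [FiniteDimensional F A] [Nontrivial A] (h : ∀ z : A, (∀ a, z * a * z = 0) → z = 0) :
    IsSemisimpleAlg F A := by
  have : IsArtinianRing A := IsArtinianRing.of_finite F A
  have key : ∀ n : ℕ, (Ring.jacobson A) ^ (n + 1) = ⊥ → Ring.jacobson A = ⊥ := by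
    intro n
    induction n with
    | zero => intro h0; rwa [zero_add, Submodule.pow_one] at h0
    | succ n ih =>
      intro h0
      apply ih
      rw [eq_bot_iff]
      intro z hz
      refine h z fun a => ?_
      have h1 : z * (a * z) ∈ (Ring.jacobson A) ^ (n + 1) * (Ring.jacobson A) ^ (n + 1) :=
        Ideal.mul_mem_mul hz (Ideal.mul_mem_left _ _ hz)
      rw [← Submodule.pow_add _ n.succ_ne_zero, show n + 1 + (n + 1) = n + (n + 1 + 1) by ring,
        Submodule.pow_add _ (n + 1).succ_ne_zero, h0] at h1
      rw [mul_assoc]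
      simpa using h1
  have hJ : Ring.jacobson A = ⊥ := by
    obtain ⟨n, hn⟩ := IsArtinianRing.isNilpotent_jacobson_bot (R := A)
    rw [Ideal.jacobson_bot] at hn
    refine key n ?_
    rw [Ideal.IsTwoSided.pow_succ, hn]
    simp
  have : IsSemisimpleRing A := IsArtinianRing.isSemisimpleRing_iff_jacobson.mpr hJ
  obtain ⟨r, K, d, i1, i2, hf, hd, ⟨φ⟩⟩ :=
    IsSemisimpleRing.exists_algEquiv_pi_matrix_divisionRing_finite F A
  refine ⟨r, K, d, i1, i2, ?_, fun i => Nat.pos_of_ne_zero (hd i).ne, hf, ⟨φ⟩⟩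
  -- without any block the algebra would be zero
  rcases Nat.eq_zero_or_pos r with rfl | hr
  · exact absurd (φ.injective (Subsingleton.elim (φ 0) (φ 1))) zero_ne_one
  · exact hr

theorem IsSemisimpleAlg.corner {F : Type u} {A : Type v} [Field F] [Ring A] [Algebra F A]
    [FiniteDimensional F A] (h : IsSemisimpleAlg F A) {e : A} (he : IsIdempotentElem e)
    (h0 : e ≠ 0) : IsSemisimpleAlg F he.Corner := by
  have hfin : FiniteDimensional F he.Corner :=
    FiniteDimensional.of_injective
      ({ toFun := Subtype.val, map_add' := fun _ _ => rfl, map_smul' := fun _ _ => rfl } :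
        he.Corner →ₗ[F] A) Subtype.val_injective
  have hnt : Nontrivial he.Corner := ⟨⟨1, 0, fun h1 => h0 (congrArg Subtype.val h1)⟩⟩
  refine isSemisimpleAlg_of_semiprime fun z hz => ?_
  apply Subtype.ext
  refine h.eq_zero_of_mul_mul_self fun a => ?_
  have h1 := (Subsemigroup.mem_corner_iff he).mp z.2
  have h2 := congrArg Subtype.val (hz ⟨e * a * e, a, rfl⟩)
  change z.1 * (e * a * e) * z.1 = 0 at h2
  calc z.1 * a * z.1 = (z.1 * e) * a * (e * z.1) := by rw [h1.1, h1.2]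
    _ = z.1 * (e * a * e) * z.1 := by simp only [mul_assoc]
    _ = 0 := h2

theorem IsSemisimpleAlg.center {F : Type u} {A : Type v} [Field F] [Ring A] [Algebra F A]
    [FiniteDimensional F A] [Nontrivial A] (h : IsSemisimpleAlg F A) :
    IsSemisimpleAlg F (Subalgebra.center F A) := by
  refine isSemisimpleAlg_of_semiprime fun z hz => ?_
  apply Subtype.ext
  refine h.eq_zero_of_mul_mul_self fun a => ?_
  have h2 := congrArg Subtype.val (hz 1)
  simp only [mul_one, MulMemClass.coe_mul, ZeroMemClass.coe_zero] at h2
  rw [← Subalgebra.mem_center_iff.mp z.2 a, mul_assoc, h2, mul_zero]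

theorem eq_zero_of_mul_mul_self_pi_matrix {F : Type u} [Field F] {ι : Type*} {κ : ι → Type*}
    [∀ i, Fintype (κ i)] (z : ∀ i, Matrix (κ i) (κ i) F) (hz : ∀ a, z * a * z = 0) : z = 0 := by
  classical
  funext i
  ext j k
  have h2 := congrFun (congrFun (congrFun (hz (Pi.single i (Matrix.single k j 1))) i) j) k
  simp only [Pi.mul_apply, Pi.single_eq_same, Pi.zero_apply, Matrix.zero_apply] at h2
  rw [Matrix.mul_assoc, Matrix.mul_apply, Finset.sum_eq_single k] at h2
  · simpa using h2
  · intro b _ hb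
    simp [Matrix.single_mul_apply_of_ne, hb]
  · simp

/-- A product of matrix algebras over the ground field is symmetric: the sum of the traces is a
nonsingular functional. -/
theorem isSymmetricAlg_pi_matrix (F : Type u) [Field F] {ι : Type*} [Fintype ι] {κ : ι → Type*}
    [∀ i, Fintype (κ i)] [∀ i, DecidableEq (κ i)] :
    IsSymmetricAlg F (∀ i, Matrix (κ i) (κ i) F) := by
  classical
  let α : (∀ i, Matrix (κ i) (κ i) F) →ₗ[F] F :=
    ∑ i, (Matrix.traceLinearMap (κ i) F F).comp (LinearMap.proj i)
  have hα : ∀ f, α f = ∑ i, (f i).trace := fun f => by simp [α]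
  have hsymm : ∀ f g, α (f * g) = α (g * f) := fun f g => by
    simp only [hα, Pi.mul_apply]
    exact Finset.sum_congr rfl fun i _ => Matrix.trace_mul_comm _ _
  have hns : ∀ f, (∀ a, α (a * f) = 0) → f = 0 := fun f hf => by
    funext i
    ext j k
    have h1 := hf (Pi.single i (Matrix.single k j 1))
    rw [hα, Finset.sum_eq_single i] at h1
    · simpa [Matrix.trace_single_mul] using h1
    · intro b _ hb
      simp [Pi.single_eq_of_ne hb]
    · simp
  refine ⟨α, fun f => ⟨⟨hns f, ?_⟩, ⟨fun h => hns f fun a => ?_, ?_⟩⟩, hsymm⟩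
  · rintro rfl a; simp
  · rw [hsymm]; exact h a
  · rintro rfl a; simp

theorem IsSymmetricAlg.of_algEquiv {F : Type u} {A : Type v} {B : Type w} [Field F] [Ring A]
    [Algebra F A] [Ring B] [Algebra F B] (φ : A ≃ₐ[F] B) (h : IsSymmetricAlg F B) :
    IsSymmetricAlg F A := by
  obtain ⟨α, h1, h2⟩ := h
  refine ⟨α.comp φ.toLinearMap, fun f => ⟨?_, ?_⟩, fun f g => ?_⟩
  · rw [← map_eq_zero_iff φ φ.injective, ← (h1 (φ f)).1, φ.surjective.forall]
    simp
  · rw [← map_eq_zero_iff φ φ.injective, ← (h1 (φ f)).2, φ.surjective.forall]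
    simp
  · simp [h2]

/-- A spanning system of nonzero matrix units identifies an algebra with a product of matrix
algebras. The unit of the algebra needs no separate hypothesis, since the sum of the diagonal
matrix units acts as the identity on their span. -/
theorem nonempty_algEquiv_of_matrixUnits {F : Type u} {A : Type v} [Field F] [Ring A] [Algebra F A]
    {ι : Type*} [Fintype ι] {κ : ι → Type*} [∀ i, Fintype (κ i)]
    [∀ i, DecidableEq (κ i)] (e : ∀ i, κ i → κ i → A)
    (hmul : ∀ i a b c d, e i a b * e i c d = if b = c then e i a d else 0)
    (hne : ∀ i j, i ≠ j → ∀ a b c d, e i a b * e j c d = 0)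
    (h0 : ∀ i a b, e i a b ≠ 0)
    (hspan : ∀ x : A, x ∈ Submodule.span F {y | ∃ i a b, e i a b = y}) :
    Nonempty ((∀ i, Matrix (κ i) (κ i) F) ≃ₐ[F] A) := by
  classical
  let Ψ : (∀ i, Matrix (κ i) (κ i) F) →ₗ[F] A :=
    { toFun := fun f => ∑ i, ∑ a, ∑ b, f i a b • e i a b
      map_add' := fun f g => by
        simp only [Pi.add_apply, Matrix.add_apply, add_smul, Finset.sum_add_distrib]
      map_smul' := fun r f => by
        simp only [Pi.smul_apply, Matrix.smul_apply, smul_eq_mul, mul_smul, Finset.smul_sum,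
          RingHom.id_apply] }
  have hΨ : ∀ f, Ψ f = ∑ i, ∑ a, ∑ b, f i a b • e i a b := fun _ => rfl
  have hΨr : ∀ f j c d, Ψ f * e j c d = ∑ a, f j a c • e j a d := by
    intro f j c d
    rw [hΨ, Finset.sum_mul, Finset.sum_eq_single j]
    · rw [Finset.sum_mul]
      refine Finset.sum_congr rfl fun a _ => ?_
      rw [Finset.sum_mul, Finset.sum_eq_single c]
      · rw [smul_mul_assoc, hmul, if_pos rfl]
      · intro b _ hb
        rw [smul_mul_assoc, hmul, if_neg hb, smul_zero]
      · simp
    · intro i _ hi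
      simp only [Finset.sum_mul, smul_mul_assoc, hne i j hi, smul_zero, Finset.sum_const_zero]
    · simp
  have hone : Ψ 1 = 1 := by
    have h1 : ∀ x : A, Ψ 1 * x = x := by
      intro x
      induction hspan x using Submodule.span_induction with
      | mem x hx =>
        obtain ⟨i, a, b, rfl⟩ := hx
        rw [hΨr, Finset.sum_eq_single a]
        · simp
        · intro c _ hc
          simp [Matrix.one_apply_ne hc]
        · simp
      | zero => simp
      | add x y _ _ hx hy => rw [mul_add, hx, hy]
      | smul r x _ hx => rw [mul_smul_comm, hx]
    simpa using h1 1
  have hΨmul : ∀ f g, Ψ (f * g) = Ψ f * Ψ g := by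
    intro f g
    rw [hΨ g]
    simp only [Finset.mul_sum, mul_smul_comm, hΨr, Finset.smul_sum, smul_smul]
    rw [hΨ]
    refine Finset.sum_congr rfl fun i _ => ?_
    simp only [Pi.mul_apply, Matrix.mul_apply, Finset.sum_smul]
    refine Finset.sum_comm.trans ((Finset.sum_congr rfl fun b _ => ?_).trans Finset.sum_comm)
    refine Finset.sum_comm.trans
      (Finset.sum_congr rfl fun c _ => Finset.sum_congr rfl fun a _ => ?_)
    rw [mul_comm]
  refine ⟨AlgEquiv.ofBijective (AlgHom.ofLinearMap Ψ hone hΨmul) ⟨?_, ?_⟩⟩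
  · rw [injective_iff_map_eq_zero]
    intro f hf
    replace hf : Ψ f = 0 := hf
    funext j
    ext a c
    have h1 : e j a a * (Ψ f * e j c c) = f j a c • e j a c := by
      rw [hΨr, Finset.mul_sum, Finset.sum_eq_single a]
      · rw [mul_smul_comm, hmul, if_pos rfl]
      · intro b _ hb
        rw [mul_smul_comm, hmul, if_neg (Ne.symm hb), smul_zero]
      · simp
    rw [hf, zero_mul, mul_zero] at h1
    exact (smul_eq_zero.mp h1.symm).resolve_right (h0 j a c)
  · intro x
    change x ∈ LinearMap.range Ψ
    refine (Submodule.span_le.mpr ?_) (hspan x)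
    rintro _ ⟨i, a, b, rfl⟩
    refine ⟨Pi.single i (Matrix.single a b 1), ?_⟩
    rw [hΨ, Finset.sum_eq_single i]
    · rw [Finset.sum_eq_single a]
      · rw [Finset.sum_eq_single b]
        · simp
        · intro d _ hd
          simp [hd.symm]
        · simp
      · intro c _ hc
        simp [hc.symm]
      · simp
    · intro j _ hj
      simp [Pi.single_eq_of_ne hj]
    · simp

/-! ### Kronecker products of families of matrices -/

/-- The Kronecker product of a finite family of square matrices, a matrix indexed by the product of
the index sets, as a multilinear map. -/
def piKronecker (F : Type w) [Field F] {ι : Type v} [Fintype ι] (X : ι → Type u) :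
    MultilinearMap F (fun i => Matrix (X i) (X i) F) (Matrix (∀ i, X i) (∀ i, X i) F) :=
  MultilinearMap.pi fun y => MultilinearMap.pi fun z =>
    (MultilinearMap.mkPiAlgebra F ι F).compLinearMap fun i =>
      Matrix.entryLinearMap F F (y i) (z i)

section Kronecker

variable {F : Type w} [Field F] {ι : Type v} [Fintype ι] {X : ι → Type u}

theorem piKronecker_apply (m : ∀ i, Matrix (X i) (X i) F) (y z : ∀ i, X i) :
    piKronecker F X m y z = ∏ i, m i (y i) (z i) := by
  change MultilinearMap.mkPiAlgebra F ι F (fun i => m i (y i) (z i)) = _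
  exact MultilinearMap.mkPiAlgebra_apply _

theorem piKronecker_mul [DecidableEq ι] [∀ i, Fintype (X i)] (m m' : ∀ i, Matrix (X i) (X i) F) :
    piKronecker F X m * piKronecker F X m' = piKronecker F X (fun i => m i * m' i) := by
  ext y z
  simp only [Matrix.mul_apply, piKronecker_apply, Finset.prod_univ_sum, Fintype.piFinset_univ,
    Finset.prod_mul_distrib]

theorem piKronecker_diagonal [∀ i, DecidableEq (X i)] (d : ∀ i, X i → F) :
    piKronecker F X (fun i => Matrix.diagonal (d i)) =
      Matrix.diagonal fun y => ∏ i, d i (y i) := by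
  ext y z
  rw [piKronecker_apply]
  by_cases h : y = z
  · subst h; simp
  · obtain ⟨i, hi⟩ := Function.ne_iff.mp h
    rw [Matrix.diagonal_apply_ne _ h]
    exact Finset.prod_eq_zero (Finset.mem_univ i) (Matrix.diagonal_apply_ne _ hi)

theorem piKronecker_one [∀ i, DecidableEq (X i)] :
    piKronecker F X (fun _ => 1) = 1 := by
  simp only [← Matrix.diagonal_one, piKronecker_diagonal, Finset.prod_const_one]

theorem piKronecker_eq_zero {m : ∀ i, Matrix (X i) (X i) F} {i : ι} (h : m i = 0) :
    piKronecker F X m = 0 := (piKronecker F X).map_coord_zero i h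

theorem piKronecker_ne_zero {m : ∀ i, Matrix (X i) (X i) F} (h : ∀ i, m i ≠ 0) :
    piKronecker F X m ≠ 0 := by
  have h1 : ∀ i, ∃ y z, m i y z ≠ 0 := fun i => by
    by_contra! h2
    exact h i (Matrix.ext h2)
  choose y z hyz using h1
  intro h0
  have h2 := congrFun (congrFun h0 y) z
  rw [piKronecker_apply] at h2
  exact Finset.prod_ne_zero_iff.mpr (fun i _ => hyz i) h2

end Kronecker

/-- A multilinear map sends a tuple of elements of spans into a submodule as soon as it sends there
all tuples of spanning vectors. -/
theorem MultilinearMap.map_mem_of_mem_span {F : Type w} [Field F] {ι : Type v} [Fintype ι]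
    [DecidableEq ι] {M : ι → Type*} {M' : Type*} [∀ i, AddCommGroup (M i)] [∀ i, Module F (M i)]
    [AddCommGroup M'] [Module F M'] (f : MultilinearMap F M M') (N : Submodule F M')
    {κ : Type*} [Fintype κ] (v : ∀ i, κ → M i) (hv : ∀ k : ι → κ, f (fun i => v i (k i)) ∈ N)
    (m : ∀ i, M i) (hm : ∀ i, m i ∈ Submodule.span F (Set.range (v i))) : f m ∈ N := by
  have h1 : ∀ i, ∃ c : κ → F, ∑ k, c k • v i k = m i := fun i =>
    (Submodule.mem_span_range_iff_exists_fun F).mp (hm i)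
  choose c hc using h1
  have h2 : m = fun i => ∑ k, c i k • v i k := funext fun i => (hc i).symm
  rw [h2, MultilinearMap.map_sum f (fun i k => c i k • v i k)]
  refine N.sum_mem fun r _ => ?_
  rw [MultilinearMap.map_smul_univ f (fun i => c i (r i)) (fun i => v i (r i))]
  exact N.smul_mem _ (hv r)

/-! ### The trivial scheme -/

namespace AssocScheme

section Trivial

variable (F : Type w) [Field F] {U : Type u} [Fintype U] [DecidableEq U] [Nontrivial U]

/-- The indicator vector of the points in relation `i` to the base point `x` of a trivial scheme:
`{x}` for `i = 0` and its complement for `i = 1`. -/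
def sphereVec (x : U) (i : Fin 2) : U → F := fun y => if (trivialScheme U).rel x y = i then 1 else 0

/-- The block `E_i^* J E_j^*` of the all-ones matrix `J`. -/
def sphereBlock (x : U) (i j : Fin 2) : Matrix U U F :=
  Matrix.vecMulVec (sphereVec F x i) (sphereVec F x j)

/-- The squared length of the indicator vector of the `i`-th sphere, that is, the valency `k_i` as
an element of `F`. -/
def sphereCard (U : Type u) [Fintype U] (i : Fin 2) : F :=
  if i = 0 then 1 else (Fintype.card U : F) - 1

variable {F}

theorem trivialScheme_rel_eq_zero {x y : U} : (trivialScheme U).rel x y = 0 ↔ x = y :=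
  (trivialScheme U).rel_eq_zero x y

theorem trivialScheme_rel_eq_one {x y : U} : (trivialScheme U).rel x y = 1 ↔ x ≠ y := by
  have h : ∀ r : Fin 2, r = 1 ↔ ¬ r = 0 := by decide
  exact (h _).trans (not_congr trivialScheme_rel_eq_zero)

theorem sphereVec_zero_apply (x y : U) : sphereVec F x 0 y = if x = y then 1 else 0 := by
  simp only [sphereVec, trivialScheme_rel_eq_zero]

theorem sphereVec_one_apply (x y : U) : sphereVec F x 1 y = if x = y then 0 else 1 := by
  simp only [sphereVec, trivialScheme_rel_eq_one, ite_not]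

theorem sphereVec_ne_zero (x : U) (i : Fin 2) : sphereVec F x i ≠ 0 := by
  obtain ⟨y, hy⟩ := exists_ne x
  intro h
  fin_cases i
  · have := congrFun h x
    simp [sphereVec_zero_apply] at this
  · have := congrFun h y
    simp [sphereVec_one_apply, hy.symm] at this

theorem sphereVec_mul (x : U) (i j : Fin 2) :
    (fun y => sphereVec F x i y * sphereVec F x j y) = if i = j then sphereVec F x i else 0 := by
  funext y
  by_cases h : i = j
  · subst h; simp [sphereVec]
  · rw [if_neg h]
    simp only [sphereVec, ite_mul, one_mul, zero_mul, Pi.zero_apply]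
    split_ifs with h1 h2 <;> first | rfl | exact absurd (h1.symm.trans h2) h

theorem dualIdem_trivialScheme (x : U) (i : Fin 2) :
    (trivialScheme U).dualIdem F x i = Matrix.diagonal (sphereVec F x i) := rfl

theorem sphereVec_dotProduct (x : U) (i j : Fin 2) :
    sphereVec F x i ⬝ᵥ sphereVec F x j = if i = j then sphereCard F U i else 0 := by
  change ∑ y, (fun y => sphereVec F x i y * sphereVec F x j y) y = _
  rw [sphereVec_mul]
  by_cases h : i = j
  · subst h
    simp only [if_true]
    fin_cases i
    · simp [sphereVec_zero_apply, sphereCard]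
    · have h1 : ∀ y, sphereVec F x 1 y = 1 - (if x = y then 1 else 0) := fun y => by
        rw [sphereVec_one_apply]; split_ifs <;> simp
      simp [h1, sphereCard]
  · simp [h]

theorem sphereBlock_mul (x : U) (i j k l : Fin 2) :
    sphereBlock F x i j * sphereBlock F x k l =
      if j = k then sphereCard F U j • sphereBlock F x i l else 0 := by
  rw [sphereBlock, sphereBlock, Matrix.vecMulVec_mul_vecMulVec, sphereVec_dotProduct]
  split_ifs
  · rw [sphereBlock, Matrix.vecMulVec_smul]
  · simp

theorem dualIdem_mul_sphereBlock (x : U) (k i j : Fin 2) :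
    (trivialScheme U).dualIdem F x k * sphereBlock F x i j =
      if k = i then sphereBlock F x i j else 0 := by
  ext y z
  rw [dualIdem_trivialScheme, Matrix.diagonal_mul, sphereBlock, Matrix.vecMulVec_apply, ← mul_assoc,
    congrFun (sphereVec_mul x k i) y]
  split_ifs with h
  · rw [h, Matrix.vecMulVec_apply]
  · simp

theorem sphereBlock_mul_dualIdem (x : U) (k i j : Fin 2) :
    sphereBlock F x i j * (trivialScheme U).dualIdem F x k =
      if j = k then sphereBlock F x i j else 0 := by
  ext y z
  rw [dualIdem_trivialScheme, Matrix.mul_diagonal, sphereBlock, Matrix.vecMulVec_apply, mul_assoc,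
    congrFun (sphereVec_mul x j k) z]
  split_ifs with h
  · rw [Matrix.vecMulVec_apply]
  · simp

theorem dualIdem_mul_dualIdem (x : U) (i j : Fin 2) :
    (trivialScheme U).dualIdem F x i * (trivialScheme U).dualIdem F x j =
      if i = j then (trivialScheme U).dualIdem F x i else 0 := by
  rw [dualIdem_trivialScheme, dualIdem_trivialScheme, Matrix.diagonal_mul_diagonal, sphereVec_mul]
  split_ifs
  · rfl
  · exact Matrix.diagonal_zero

theorem dualIdem_trivialScheme_ne_zero (x : U) (i : Fin 2) :
    (trivialScheme U).dualIdem F x i ≠ 0 := fun h =>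
  sphereVec_ne_zero (F := F) x i (Matrix.diagonal_injective (h.trans Matrix.diagonal_zero.symm))

theorem sphereBlock_ne_zero (x : U) (i j : Fin 2) : sphereBlock F x i j ≠ 0 := by
  obtain ⟨y, hy⟩ := Function.ne_iff.mp (sphereVec_ne_zero (F := F) x i)
  obtain ⟨z, hz⟩ := Function.ne_iff.mp (sphereVec_ne_zero (F := F) x j)
  intro h
  have := congrFun (congrFun h y) z
  rw [sphereBlock, Matrix.vecMulVec_apply] at this
  exact mul_ne_zero hy hz this

theorem dualIdem_zero_eq (x : U) :
    (trivialScheme U).dualIdem F x 0 = sphereBlock F x 0 0 := by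
  ext y z
  simp only [dualIdem_trivialScheme, sphereBlock, Matrix.vecMulVec_apply, sphereVec_zero_apply,
    Matrix.diagonal_apply]
  split_ifs <;> simp_all

theorem adjMatrix_zero : (trivialScheme U).adjMatrix F 0 = 1 := by
  ext y z
  simp [adjMatrix, trivialScheme_rel_eq_zero, Matrix.one_apply]

theorem dualIdem_zero_add_one (x : U) :
    (trivialScheme U).dualIdem F x 0 + (trivialScheme U).dualIdem F x 1 = 1 := by
  rw [dualIdem_trivialScheme, dualIdem_trivialScheme, Matrix.diagonal_add, ← Matrix.diagonal_one]
  congr 1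
  funext y
  rw [sphereVec_zero_apply, sphereVec_one_apply]
  split_ifs <;> simp

theorem one_add_adjMatrix_one (x : U) :
    1 + (trivialScheme U).adjMatrix F 1 = ∑ i, ∑ j, sphereBlock F x i j := by
  ext y z
  have h : ∀ y, sphereVec F x 0 y + sphereVec F x 1 y = 1 := fun y => by
    rw [sphereVec_zero_apply, sphereVec_one_apply]; split_ifs <;> simp
  have h1 : (1 + (trivialScheme U).adjMatrix F 1) y z = 1 := by
    simp only [adjMatrix, trivialScheme_rel_eq_one, Matrix.add_apply, Matrix.one_apply,
      Matrix.of_apply, ite_not]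
    split_ifs <;> simp
  rw [h1]
  simp only [sphereBlock, Fin.sum_univ_two, Matrix.add_apply, Matrix.vecMulVec_apply]
  linear_combination (-1 : F) * (sphereVec F x 0 y + sphereVec F x 1 y) * h z - h y

/-- Since `J = A_0 + A_1`, the blocks of the all-ones matrix lie in the span of the products
`E_i^* A_s E_j^*`. -/
theorem sphereBlock_eq_add (x : U) (i j : Fin 2) :
    sphereBlock F x i j = ∑ s, (trivialScheme U).dualIdem F x i * (trivialScheme U).adjMatrix F s *
      (trivialScheme U).dualIdem F x j := by
  rw [Fin.sum_univ_two, adjMatrix_zero, ← add_mul, ← mul_add, one_add_adjMatrix_one x]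
  simp only [Finset.mul_sum, Finset.sum_mul, dualIdem_mul_sphereBlock, ite_mul, zero_mul,
    sphereBlock_mul_dualIdem]
  rw [Finset.sum_eq_single i, Finset.sum_eq_single j]
  · simp
  · intro b _ hb; simp [hb]
  · simp
  · intro b _ hb; simp [hb.symm]
  · simp

end Trivial

end AssocScheme

namespace AssocScheme

/-! ### The Terwilliger algebra of the factorial scheme as a Kronecker product -/

section Generators

variable {F : Type w} [Field F] {n : ℕ} {U : Fin n → Type u} [∀ h, Fintype (U h)]
  [∀ h, DecidableEq (U h)] [∀ h, Nontrivial (U h)]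

theorem adjMatrix_factorialScheme (g : Fin n → Fin 2) :
    (factorialScheme U).adjMatrix F g =
      piKronecker F U fun h => (trivialScheme (U h)).adjMatrix F (g h) := by
  ext y z
  rw [piKronecker_apply]
  simp only [adjMatrix, Matrix.of_apply, Finset.prod_boole, Finset.mem_univ, true_implies]
  exact if_congr funext_iff rfl rfl

theorem dualIdem_factorialScheme (x : ∀ h, U h) (g : Fin n → Fin 2) :
    (factorialScheme U).dualIdem F x g =
      piKronecker F U fun h => (trivialScheme (U h)).dualIdem F (x h) (g h) := by
  simp only [dualIdem, piKronecker_diagonal, Finset.prod_boole, Finset.mem_univ, true_implies]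
  congr 1
  funext y
  exact if_congr funext_iff rfl rfl

/-- The span of the products `E_i^* A_s E_j^*` for a trivial scheme; this is the underlying space of
its Terwilliger algebra. -/
def tripleSpan (F : Type w) [Field F] {V : Type u} [Fintype V] [DecidableEq V] [Nontrivial V]
    (x : V) : Submodule F (Matrix V V F) :=
  Submodule.span F (Set.range fun t : Fin 2 × Fin 2 × Fin 2 =>
    (trivialScheme V).dualIdem F x t.1 * (trivialScheme V).adjMatrix F t.2.1 *
      (trivialScheme V).dualIdem F x t.2.2)

theorem sphereBlock_mem_tripleSpan {V : Type u} [Fintype V] [DecidableEq V] [Nontrivial V]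
    (x : V) (i j : Fin 2) : sphereBlock F x i j ∈ tripleSpan F x := by
  rw [sphereBlock_eq_add]
  exact Submodule.sum_mem _ fun s _ => Submodule.subset_span ⟨(i, s, j), rfl⟩

theorem dualIdem_mem_tripleSpan {V : Type u} [Fintype V] [DecidableEq V] [Nontrivial V]
    (x : V) (i : Fin 2) : (trivialScheme V).dualIdem F x i ∈ tripleSpan F x :=
  Submodule.subset_span ⟨(i, 0, i), by simp [adjMatrix_zero, dualIdem_mul_dualIdem]⟩

theorem one_mem_tripleSpan {V : Type u} [Fintype V] [DecidableEq V] [Nontrivial V]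
    (x : V) : 1 ∈ tripleSpan F x := by
  rw [← dualIdem_zero_add_one x]
  exact add_mem (dualIdem_mem_tripleSpan x 0) (dualIdem_mem_tripleSpan x 1)

theorem adjMatrix_mem_tripleSpan {V : Type u} [Fintype V] [DecidableEq V] [Nontrivial V]
    (x : V) (i : Fin 2) : (trivialScheme V).adjMatrix F i ∈ tripleSpan F x := by
  have h0 : (trivialScheme V).adjMatrix F 0 ∈ tripleSpan F x := by
    rw [adjMatrix_zero]; exact one_mem_tripleSpan x
  fin_cases i
  · exact h0
  · have h1 := one_add_adjMatrix_one (F := F) x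
    rw [add_comm, ← eq_sub_iff_add_eq] at h1
    change (trivialScheme V).adjMatrix F 1 ∈ _
    rw [h1]
    exact sub_mem (Submodule.sum_mem _ fun i _ => Submodule.sum_mem _ fun j _ =>
      sphereBlock_mem_tripleSpan x i j) (one_mem_tripleSpan x)

theorem piKronecker_mem_terwilliger (x : ∀ h, U h) (m : ∀ h, Matrix (U h) (U h) F)
    (hm : ∀ h, m h ∈ tripleSpan F (x h)) :
    piKronecker F U m ∈ (factorialScheme U).terwilliger F x := by
  refine MultilinearMap.map_mem_of_mem_span (piKronecker F U)
    (Subalgebra.toSubmodule ((factorialScheme U).terwilliger F x)) _ (fun k => ?_) m hm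
  rw [Subalgebra.mem_toSubmodule]
  simp only [← piKronecker_mul]
  rw [← dualIdem_factorialScheme x fun h => (k h).1, ← adjMatrix_factorialScheme fun h => (k h).2.1,
    ← dualIdem_factorialScheme x fun h => (k h).2.2]
  exact mul_mem (mul_mem (Algebra.subset_adjoin (Or.inr ⟨_, rfl⟩))
    (Algebra.subset_adjoin (Or.inl ⟨_, rfl⟩))) (Algebra.subset_adjoin (Or.inr ⟨_, rfl⟩))

end Generators

/-! ### Matrix units when no valency vanishes -/

section TrivialUnits

theorem sphereCard_ne_zero {F : Type w} [Field F] {V : Type u} [Fintype V]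
    (hk : (Fintype.card V : F) - 1 ≠ 0) (i : Fin 2) : sphereCard F V i ≠ 0 := by
  rw [sphereCard]; split_ifs
  · exact one_ne_zero
  · exact hk

variable (F : Type w) [Field F] {V : Type u} [Fintype V] [DecidableEq V] [Nontrivial V] (x : V)

/-- The matrix unit `k_i⁻¹ E_i^* J E_j^*` in the Terwilliger algebra of a trivial scheme. -/
def blockUnit (i j : Fin 2) : Matrix V V F := (sphereCard F V i)⁻¹ • sphereBlock F x i j

/-- The idempotent `E_1^* - k_1⁻¹ E_1^* J E_1^*`, which spans the complement of the `2 × 2` matrix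
algebra in the Terwilliger algebra of a trivial scheme. -/
def blockCompl : Matrix V V F := (trivialScheme V).dualIdem F x 1 - blockUnit F x 1 1

/-- The basis of the Terwilliger algebra of a trivial scheme formed by the matrix units and the
complementary idempotent; the latter vanishes when there are only two points. -/
def unitBasis : Option (Fin 2 × Fin 2) → Matrix V V F
  | none => blockCompl F x
  | some (i, j) => blockUnit F x i j

variable {F x}

theorem blockUnit_mem_tripleSpan (i j : Fin 2) : blockUnit F x i j ∈ tripleSpan F x :=
  Submodule.smul_mem _ _ (sphereBlock_mem_tripleSpan x i j)

theorem blockCompl_mem_tripleSpan : blockCompl F x ∈ tripleSpan F x :=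
  sub_mem (dualIdem_mem_tripleSpan x 1) (blockUnit_mem_tripleSpan 1 1)

theorem blockUnit_ne_zero (hk : (Fintype.card V : F) - 1 ≠ 0) (i j : Fin 2) :
    blockUnit F x i j ≠ 0 :=
  smul_ne_zero (inv_ne_zero (sphereCard_ne_zero hk i)) (sphereBlock_ne_zero x i j)

theorem blockUnit_mul_blockUnit (hk : (Fintype.card V : F) - 1 ≠ 0) (i j k l : Fin 2) :
    blockUnit F x i j * blockUnit F x k l = if j = k then blockUnit F x i l else 0 := by
  rw [blockUnit, blockUnit, smul_mul_smul_comm, sphereBlock_mul]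
  split_ifs with h
  · subst h
    rw [smul_smul, mul_assoc, inv_mul_cancel₀ (sphereCard_ne_zero hk j), mul_one, blockUnit]
  · simp

theorem dualIdem_mul_blockUnit (k i j : Fin 2) :
    (trivialScheme V).dualIdem F x k * blockUnit F x i j =
      if k = i then blockUnit F x i j else 0 := by
  rw [blockUnit, mul_smul_comm, dualIdem_mul_sphereBlock, smul_ite, smul_zero]

theorem blockUnit_mul_dualIdem (k i j : Fin 2) :
    blockUnit F x i j * (trivialScheme V).dualIdem F x k =
      if j = k then blockUnit F x i j else 0 := by
  rw [blockUnit, smul_mul_assoc, sphereBlock_mul_dualIdem, smul_ite, smul_zero]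

theorem blockCompl_mul_blockUnit (hk : (Fintype.card V : F) - 1 ≠ 0) (i j : Fin 2) :
    blockCompl F x * blockUnit F x i j = 0 := by
  rw [blockCompl, sub_mul, dualIdem_mul_blockUnit, blockUnit_mul_blockUnit hk]
  split_ifs with h
  · rw [h, sub_self]
  · simp

theorem blockUnit_mul_blockCompl (hk : (Fintype.card V : F) - 1 ≠ 0) (i j : Fin 2) :
    blockUnit F x i j * blockCompl F x = 0 := by
  rw [blockCompl, mul_sub, blockUnit_mul_dualIdem, blockUnit_mul_blockUnit hk]
  split_ifs with h
  · rw [h, sub_self]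
  · simp

theorem blockCompl_mul_blockCompl (hk : (Fintype.card V : F) - 1 ≠ 0) :
    blockCompl F x * blockCompl F x = blockCompl F x := by
  nth_rewrite 2 [blockCompl]
  rw [mul_sub, blockCompl_mul_blockUnit hk, sub_zero, blockCompl, sub_mul, dualIdem_mul_dualIdem,
    blockUnit_mul_dualIdem]
  simp

theorem blockCompl_apply_of_ne {y z : V} (hy : x ≠ y) (hz : x ≠ z) :
    blockCompl F x y z = (if y = z then 1 else 0) - ((Fintype.card V : F) - 1)⁻¹ := by
  simp [blockCompl, blockUnit, dualIdem_trivialScheme, sphereBlock, Matrix.vecMulVec_apply,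
    sphereVec_one_apply, Matrix.diagonal_apply, sphereCard, hy, hz]

theorem blockCompl_apply_eq_zero {y z : V} (h : x = y ∨ x = z) : blockCompl F x y z = 0 := by
  rcases h with rfl | rfl
  · simp [blockCompl, blockUnit, dualIdem_trivialScheme, sphereBlock, Matrix.vecMulVec_apply,
      sphereVec_one_apply, Matrix.diagonal_apply]
  · simp only [blockCompl, blockUnit, dualIdem_trivialScheme, sphereBlock, Matrix.sub_apply,
      Matrix.smul_apply, Matrix.vecMulVec_apply, sphereVec_one_apply, Matrix.diagonal_apply]
    split_ifs <;> simp_all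

theorem blockCompl_eq_zero (h : ¬ 2 < Fintype.card V) : blockCompl F x = 0 := by
  have h2 : Fintype.card V = 2 := le_antisymm (not_lt.mp h) Fintype.one_lt_card
  ext y z
  by_cases hy : x = y
  · exact blockCompl_apply_eq_zero (Or.inl hy)
  by_cases hz : x = z
  · exact blockCompl_apply_eq_zero (Or.inr hz)
  have hyz : y = z := by
    by_contra hyz
    have := Finset.card_le_univ ({x, y, z} : Finset V)
    rw [Finset.card_eq_three.mpr ⟨x, y, z, hy, hz, hyz, rfl⟩, h2] at this
    omega
  rw [blockCompl_apply_of_ne hy hz, if_pos hyz, h2]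
  norm_num

theorem blockCompl_ne_zero (hk : (Fintype.card V : F) - 1 ≠ 0) (h : 2 < Fintype.card V) :
    blockCompl F x ≠ 0 := by
  obtain ⟨y, hy, z, hz, hyz⟩ : ∃ y, x ≠ y ∧ ∃ z, x ≠ z ∧ y ≠ z := by
    obtain ⟨y, hy⟩ := exists_ne x
    obtain ⟨z, hz⟩ : ∃ z, z ∉ ({x, y} : Finset V) := by
      by_contra! hall
      have h1 : (Finset.univ : Finset V) ⊆ {x, y} := fun z _ => hall z
      have := (Finset.card_le_card h1).trans Finset.card_le_two
      rw [Finset.card_univ] at this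
      omega
    simp only [Finset.mem_insert, Finset.mem_singleton, not_or] at hz
    exact ⟨y, hy.symm, z, Ne.symm hz.1, Ne.symm hz.2⟩
  intro h0
  have := congrFun (congrFun h0 y) z
  rw [blockCompl_apply_of_ne hy hz, if_neg hyz, zero_sub] at this
  exact neg_ne_zero.mpr (inv_ne_zero hk) this

theorem tripleSpan_le_span_unitBasis (hk : (Fintype.card V : F) - 1 ≠ 0) :
    tripleSpan F x ≤ Submodule.span F (Set.range (unitBasis F x)) := by
  set N := Submodule.span F (Set.range (unitBasis F x)) with hN
  have hu : ∀ i j, blockUnit F x i j ∈ N := fun i j => Submodule.subset_span ⟨some (i, j), rfl⟩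
  have hs : ∀ i j, sphereBlock F x i j ∈ N := fun i j => by
    have h1 : sphereBlock F x i j = sphereCard F V i • blockUnit F x i j := by
      rw [blockUnit, smul_smul, mul_inv_cancel₀ (sphereCard_ne_zero hk i), one_smul]
    rw [h1]
    exact N.smul_mem _ (hu i j)
  have hd : ∀ i, (trivialScheme V).dualIdem F x i ∈ N := fun i => by
    fin_cases i
    · change (trivialScheme V).dualIdem F x 0 ∈ N
      rw [dualIdem_zero_eq]; exact hs 0 0
    · have h1 : (trivialScheme V).dualIdem F x 1 = blockCompl F x + blockUnit F x 1 1 := by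
        rw [blockCompl, sub_add_cancel]
      change (trivialScheme V).dualIdem F x 1 ∈ N
      rw [h1]
      exact N.add_mem (Submodule.subset_span ⟨none, rfl⟩) (hu 1 1)
  rw [tripleSpan, Submodule.span_le]
  rintro _ ⟨⟨i, s, j⟩, rfl⟩
  have h0 : (trivialScheme V).dualIdem F x i * (trivialScheme V).adjMatrix F 0 *
      (trivialScheme V).dualIdem F x j ∈ N := by
    rw [adjMatrix_zero, mul_one, dualIdem_mul_dualIdem]
    split_ifs
    · exact hd i
    · exact N.zero_mem
  fin_cases s
  · exact h0
  · have h1 := hs i j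
    rw [sphereBlock_eq_add, Fin.sum_univ_two] at h1
    exact (N.add_mem_iff_right h0).mp h1

end TrivialUnits

end AssocScheme

/-! ### The blocks of the Wedderburn decomposition -/

namespace FactorialScheme

/-- The tuple with entries in `{0, 1}` attached to a set of coordinates. -/
def ofFinset {n : ℕ} (V : Finset (Fin n)) : Fin n → Fin 2 := fun h => if h ∈ V then 1 else 0

theorem mem_supp {n : ℕ} {g : Fin n → Fin 2} {h : Fin n} : h ∈ supp g ↔ g h = 1 := by
  simp [supp]

theorem supp_ofFinset {n : ℕ} (V : Finset (Fin n)) : supp (ofFinset V) = V := by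
  ext h
  rw [mem_supp, ofFinset]
  split_ifs with hV <;> simp [hV]

section Blocks

variable {n : ℕ} {U : Fin n → Type u} [∀ h, Fintype (U h)]

theorem mem_big {V : Finset (Fin n)} {h : Fin n} :
    h ∈ big U V ↔ h ∈ V ∧ 2 < Fintype.card (U h) := by
  simp [big]

variable [∀ h, DecidableEq (U h)] [∀ h, Nontrivial (U h)] {p : ℕ}

/-- The set `(g ∩ i)° \ h` that labels the equivalence class of `(g, h, i)`. -/
def blockSet (m : Quotient (relD U p)) : Finset (Fin n) :=
  Quotient.lift (fun t : setD U p => big U (supp t.1.1 ∩ supp t.1.2.2) \ supp t.1.2.1)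
    (fun _ _ h => h) m

theorem blockSet_injective : Function.Injective (blockSet (U := U) (p := p)) := by
  intro m m' h
  induction m using Quotient.inductionOn with | _ t =>
  induction m' using Quotient.inductionOn with | _ t' =>
  exact Quotient.sound h

theorem card_of_mem_blockSet {m : Quotient (relD U p)} {h : Fin n} (hm : h ∈ blockSet m) :
    2 < Fintype.card (U h) := by
  induction m using Quotient.inductionOn with | _ t =>
  exact (mem_big.mp (Finset.mem_sdiff.mp hm).1).2

/-- When no valency is divisible by `p`, every set `W ⊆ a` of coordinates with more than two points
labels the equivalence class of a triple `(a, b, a)`, namely for `b = a° \ W`. -/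
theorem exists_blockSet_eq (hp : ∀ g, ¬ p ∣ (AssocScheme.factorialScheme U).valency g)
    {W a : Finset (Fin n)} (hW : ∀ h ∈ W, 2 < Fintype.card (U h)) (ha : W ⊆ a) :
    ∃ (b : Fin n → Fin 2) (h : (ofFinset a, b, ofFinset a) ∈ setD U p),
      blockSet (Quotient.mk (relD U p) ⟨(ofFinset a, b, ofFinset a), h⟩) = W := by
  refine ⟨ofFinset (big U a \ W), ⟨⟨by simp, ?_⟩, hp _⟩, ?_⟩
  · simp only [supp_ofFinset, Finset.inter_self]
    exact Finset.sdiff_subset.trans Finset.subset_union_right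
  · change big U (supp (ofFinset a) ∩ supp (ofFinset a)) \ supp (ofFinset (big U a \ W)) = W
    rw [supp_ofFinset, supp_ofFinset, Finset.inter_self, Finset.sdiff_sdiff_eq_self]
    exact fun h hh => mem_big.mpr ⟨ha hh, hW h hh⟩

theorem mem_classD (hp : ∀ g, ¬ p ∣ (AssocScheme.factorialScheme U).valency g)
    {m : Quotient (relD U p)} {a : Fin n → Fin 2} :
    a ∈ classD U p m ↔ blockSet m ⊆ supp a := by
  constructor
  · rintro ⟨b, h, rfl⟩ j hj
    have h1 := (mem_big.mp (Finset.mem_sdiff.mp hj).1).1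
    exact (Finset.mem_inter.mp h1).1
  · intro h
    obtain ⟨b, hb, he⟩ := exists_blockSet_eq hp (W := blockSet m) (a := supp a)
      (fun _ => card_of_mem_blockSet) h
    have ha : ofFinset (supp a) = a := by
      funext j
      have h1 : ∀ r : Fin 2, (if r = 1 then 1 else 0 : Fin 2) = r := by decide
      simp only [ofFinset, mem_supp, h1]
    rw [← ha]
    exact ⟨b, hb, blockSet_injective he⟩

end Blocks

end FactorialScheme

namespace AssocScheme

open FactorialScheme

theorem valency_factorialScheme {n : ℕ} {U : Fin n → Type u} [∀ h, Fintype (U h)]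
    [∀ h, DecidableEq (U h)] [∀ h, Nontrivial (U h)] (g : Fin n → Fin 2) :
    (factorialScheme U).valency g = ∏ h, if g h = 0 then 1 else Fintype.card (U h) - 1 := by
  change ∏ h, (trivialScheme (U h)).p (g h) (g h) 0 = _
  refine Finset.prod_congr rfl fun h _ => ?_
  simp only [trivialScheme]
  split_ifs <;> simp_all

section MatrixUnits

variable {F : Type w} [Field F] {n : ℕ} {U : Fin n → Type u} [∀ h, Fintype (U h)]
  [∀ h, DecidableEq (U h)] [∀ h, Nontrivial (U h)]

variable (F) in
/-- The Kronecker product of the complementary idempotents at the coordinates in `W` and of the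
matrix units with indices `a h`, `b h` at the other coordinates `h`. For `a` and `b` containing
`W` these are the matrix units of the block labelled by `W`. -/
def matrixUnit (x : ∀ h, U h) (W : Finset (Fin n)) (a b : Fin n → Fin 2) :
    Matrix (∀ h, U h) (∀ h, U h) F :=
  piKronecker F U fun h => if h ∈ W then blockCompl F (x h) else blockUnit F (x h) (a h) (b h)

variable {x : ∀ h, U h}

theorem matrixUnit_mem_terwilliger (W : Finset (Fin n)) (a b : Fin n → Fin 2) :
    matrixUnit F x W a b ∈ (factorialScheme U).terwilliger F x := by
  refine piKronecker_mem_terwilliger x _ fun h => ?_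
  split_ifs
  · exact blockCompl_mem_tripleSpan
  · exact blockUnit_mem_tripleSpan _ _

theorem matrixUnit_ne_zero (hk : ∀ h, (Fintype.card (U h) : F) - 1 ≠ 0) {W : Finset (Fin n)}
    (hW : ∀ h ∈ W, 2 < Fintype.card (U h)) (a b : Fin n → Fin 2) : matrixUnit F x W a b ≠ 0 := by
  refine piKronecker_ne_zero fun h => ?_
  split_ifs with hh
  · exact blockCompl_ne_zero (hk h) (hW h hh)
  · exact blockUnit_ne_zero (hk h) _ _

theorem matrixUnit_mul_of_ne (hk : ∀ h, (Fintype.card (U h) : F) - 1 ≠ 0) {W W' : Finset (Fin n)}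
    (hW : W ≠ W') (a b c d : Fin n → Fin 2) :
    matrixUnit F x W a b * matrixUnit F x W' c d = 0 := by
  obtain ⟨h, hh⟩ : ∃ h, ¬ (h ∈ W ↔ h ∈ W') := by
    by_contra! h1
    exact hW (Finset.ext h1)
  rw [matrixUnit, matrixUnit, piKronecker_mul]
  apply piKronecker_eq_zero (i := h)
  by_cases h1 : h ∈ W
  · have h2 : h ∉ W' := fun h2 => hh ⟨fun _ => h2, fun _ => h1⟩
    rw [if_pos h1, if_neg h2, blockCompl_mul_blockUnit (hk h)]
  · have h2 : h ∈ W' := by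
      by_contra h2
      exact hh ⟨fun h3 => absurd h3 h1, fun h3 => absurd h3 h2⟩
    rw [if_neg h1, if_pos h2, blockUnit_mul_blockCompl (hk h)]

theorem matrixUnit_mul (hk : ∀ h, (Fintype.card (U h) : F) - 1 ≠ 0) {W : Finset (Fin n)}
    {b c : Fin n → Fin 2} (hb : W ⊆ supp b) (hc : W ⊆ supp c) (a d : Fin n → Fin 2) :
    matrixUnit F x W a b * matrixUnit F x W c d = if b = c then matrixUnit F x W a d else 0 := by
  rw [matrixUnit, matrixUnit, piKronecker_mul]
  split_ifs with hbc
  · subst hbc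
    rw [matrixUnit]
    congr 1
    funext h
    split_ifs
    · exact blockCompl_mul_blockCompl (hk h)
    · rw [blockUnit_mul_blockUnit (hk h), if_pos rfl]
  · -- `b` and `c` agree on `W`, so they differ at a coordinate outside `W`
    obtain ⟨h, hh⟩ := Function.ne_iff.mp hbc
    apply piKronecker_eq_zero (i := h)
    have h1 : h ∉ W := fun h1 => hh ((mem_supp.mp (hb h1)).trans (mem_supp.mp (hc h1)).symm)
    rw [if_neg h1, if_neg h1, blockUnit_mul_blockUnit (hk h), if_neg hh]

variable (F x) in
/-- The span of the matrix units of all blocks. -/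
def matrixUnitSpan : Submodule F (Matrix (∀ h, U h) (∀ h, U h) F) :=
  Submodule.span F {y | ∃ (W : Finset (Fin n)) (a b : Fin n → Fin 2),
    (∀ h ∈ W, 2 < Fintype.card (U h)) ∧ W ⊆ supp a ∧ W ⊆ supp b ∧ matrixUnit F x W a b = y}

theorem piKronecker_mem_matrixUnitSpan (hk : ∀ h, (Fintype.card (U h) : F) - 1 ≠ 0)
    (m : ∀ h, Matrix (U h) (U h) F) (hm : ∀ h, m h ∈ tripleSpan F (x h)) :
    piKronecker F U m ∈ matrixUnitSpan F x := by
  refine MultilinearMap.map_mem_of_mem_span (piKronecker F U) _ (fun h => unitBasis F (x h))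
    (fun k => ?_) m fun h => tripleSpan_le_span_unitBasis (hk h) (hm h)
  by_cases hW : ∀ h, k h = none → 2 < Fintype.card (U h)
  · -- the coordinates at which the complementary idempotent is chosen form the label of the block
    refine Submodule.subset_span ⟨Finset.univ.filter fun h => k h = none,
      fun h => ((k h).map Prod.fst).getD 1, fun h => ((k h).map Prod.snd).getD 1,
      fun h hh => hW h (Finset.mem_filter.mp hh).2, fun h hh => ?_, fun h hh => ?_, ?_⟩
    · rw [mem_supp, (Finset.mem_filter.mp hh).2]; rfl
    · rw [mem_supp, (Finset.mem_filter.mp hh).2]; rfl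
    · rw [matrixUnit]
      congr 1
      funext h
      simp only [Finset.mem_filter, Finset.mem_univ, true_and]
      cases hkh : k h with
      | none => simp [unitBasis]
      | some q => simp [unitBasis]
  · push Not at hW
    obtain ⟨h, hh, hc⟩ := hW
    rw [piKronecker_eq_zero (i := h)]
    · exact Submodule.zero_mem _
    · rw [hh]
      exact blockCompl_eq_zero (not_lt.mpr hc)

theorem mul_mem_matrixUnitSpan (hk : ∀ h, (Fintype.card (U h) : F) - 1 ≠ 0)
    {s t : Matrix (∀ h, U h) (∀ h, U h) F} (hs : s ∈ matrixUnitSpan F x)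
    (ht : t ∈ matrixUnitSpan F x) : s * t ∈ matrixUnitSpan F x := by
  have h1 : s * t ∈ matrixUnitSpan F x * matrixUnitSpan F x := Submodule.mul_mem_mul hs ht
  refine (?_ : matrixUnitSpan F x * matrixUnitSpan F x ≤ matrixUnitSpan F x) h1
  nth_rewrite 1 2 [matrixUnitSpan]
  rw [Submodule.span_mul_span, Submodule.span_le]
  rintro _ ⟨_, ⟨W, a, b, hW, ha, hb, rfl⟩, _, ⟨W', c, d, -, hc, hd, rfl⟩, rfl⟩
  change matrixUnit F x W a b * matrixUnit F x W' c d ∈ matrixUnitSpan F x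
  by_cases hWW : W = W'
  · subst hWW
    rw [matrixUnit_mul hk hb hc]
    split_ifs
    · exact Submodule.subset_span ⟨W, a, d, hW, ha, hd, rfl⟩
    · exact Submodule.zero_mem _
  · rw [matrixUnit_mul_of_ne hk hWW]
    exact Submodule.zero_mem _

theorem terwilliger_le_matrixUnitSpan (hk : ∀ h, (Fintype.card (U h) : F) - 1 ≠ 0)
    {t : Matrix (∀ h, U h) (∀ h, U h) F} (ht : t ∈ (factorialScheme U).terwilliger F x) :
    t ∈ matrixUnitSpan F x := by
  induction ht using Algebra.adjoin_induction with
  | mem t ht =>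
    rcases ht with ⟨g, rfl⟩ | ⟨g, rfl⟩
    · rw [adjMatrix_factorialScheme]
      exact piKronecker_mem_matrixUnitSpan hk _ fun h => adjMatrix_mem_tripleSpan (x h) (g h)
    · rw [dualIdem_factorialScheme]
      exact piKronecker_mem_matrixUnitSpan hk _ fun h => dualIdem_mem_tripleSpan (x h) (g h)
  | algebraMap r =>
    rw [Algebra.algebraMap_eq_smul_one, ← piKronecker_one]
    exact Submodule.smul_mem _ _
      (piKronecker_mem_matrixUnitSpan hk _ fun h => one_mem_tripleSpan (x h))
  | add s t _ _ hs ht => exact Submodule.add_mem _ hs ht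
  | mul s t _ _ hs ht => exact mul_mem_matrixUnitSpan hk hs ht

/-- The Wedderburn decomposition of the Terwilliger algebra when `p` divides no valency. -/
theorem nonempty_terwilliger_algEquiv {p : ℕ} (hk : ∀ h, (Fintype.card (U h) : F) - 1 ≠ 0)
    (hp : ∀ g, ¬ p ∣ (factorialScheme U).valency g) :
    Nonempty ((factorialScheme U).terwilliger F x ≃ₐ[F] ∀ m : Quotient (relD U p),
      Matrix (Fin (classD U p m).ncard) (Fin (classD U p m).ncard) F) := by
  classical
  have : Fintype (Quotient (relD U p)) := Fintype.ofFinite _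
  have : ∀ m, Fintype (classD U p m) := fun m => Fintype.ofFinite _
  let e : ∀ m : Quotient (relD U p), classD U p m → classD U p m →
      (factorialScheme U).terwilliger F x :=
    fun m a b => ⟨matrixUnit F x (blockSet m) a b, matrixUnit_mem_terwilliger _ _ _⟩
  obtain ⟨φ⟩ := nonempty_algEquiv_of_matrixUnits e
    (fun m a b c d => by
      apply Subtype.ext
      change matrixUnit F x (blockSet m) a b * matrixUnit F x (blockSet m) c d = _
      rw [matrixUnit_mul hk ((mem_classD hp).mp b.2) ((mem_classD hp).mp c.2)]
      by_cases hbc : b = c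
      · subst hbc; simp [e]
      · rw [if_neg hbc, if_neg fun h => hbc (Subtype.ext h)]; rfl)
    (fun m m' hm a b c d => Subtype.ext
      (matrixUnit_mul_of_ne hk (fun h => hm (blockSet_injective h)) _ _ _ _))
    (fun m a b h => matrixUnit_ne_zero hk (fun _ => card_of_mem_blockSet) _ _
      (congrArg Subtype.val h))
    (fun t => by
      have h1 : t.1 ∈ (Submodule.span F {y | ∃ m a b, e m a b = y}).map
          ((factorialScheme U).terwilliger F x).val.toLinearMap := by
        refine (?_ : matrixUnitSpan F x ≤ _) (terwilliger_le_matrixUnitSpan hk t.2)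
        rw [matrixUnitSpan, Submodule.span_le]
        rintro _ ⟨W, a, b, hW, ha, hb, rfl⟩
        obtain ⟨c, hc, hm⟩ := exists_blockSet_eq hp hW subset_rfl
        generalize Quotient.mk (relD U p) _ = m at hm
        subst hm
        exact ⟨e m ⟨a, (mem_classD hp).mpr ha⟩ ⟨b, (mem_classD hp).mpr hb⟩,
          Submodule.subset_span ⟨m, _, _, rfl⟩, rfl⟩
      obtain ⟨s, hs, hst⟩ := h1
      have hst' : s = t := Subtype.ext hst
      exact hst' ▸ hs)
  exact ⟨φ.symm.trans (AlgEquiv.piCongrRight fun m => Matrix.reindexAlgEquiv F F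
    (Finite.equivFinOfCardEq (Nat.card_coe_set_eq _)))⟩

end MatrixUnits

end AssocScheme

/-! ### Obstructions when a valency vanishes -/

/-- A central element `z` with `z² = 0` obstructs the semisimplicity of every corner `eAe` in which
it has a nonzero component. -/
theorem not_isSemisimpleAlg_corner {F : Type u} {A : Type v} [Field F] [Ring A] [Algebra F A]
    {e : A} (he : IsIdempotentElem e) {z : A} (hc : ∀ a, a * z = z * a) (hz : z * z = 0)
    (h0 : e * z * e ≠ 0) : ¬ IsSemisimpleAlg F he.Corner := by
  intro h
  apply h0
  let y : he.Corner := ⟨e * z * e, z, rfl⟩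
  have hy : y = 0 := h.eq_zero_of_mul_mul_self fun a => Subtype.ext (by
    change e * z * e * a.1 * (e * z * e) = 0
    rw [hc e]
    calc z * e * e * a.1 * (z * e * e) = z * (e * e * a.1 * z) * e * e := by simp only [mul_assoc]
      _ = 0 := by rw [hc, ← mul_assoc z z, hz]; simp)
  exact congrArg Subtype.val hy

/-- The dimension count behind the failure of the Frobenius property: if a nonzero subalgebra `R`
of `A` and elements `c`, `d` span a free right `R`-module `cR ⊕ dR` on which every element of `A`
acts through left multiplication by an element of `R` commuting with `c` and `d`, then a nonsingular
functional of `A` would embed `R × R` into the dual space of `R`. -/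
theorem not_isFrobeniusAlg_of_free_pair {F : Type u} {A : Type v} [Field F] [Ring A] [Algebra F A]
    [FiniteDimensional F A] [Nontrivial A] (R : Subalgebra F A) (c d : A)
    (hc : ∀ r ∈ R, r * c = c * r) (hd : ∀ r ∈ R, r * d = d * r)
    (hfree : ∀ r ∈ R, ∀ s ∈ R, c * r + d * s = 0 → r = 0 ∧ s = 0)
    (hact : ∀ a : A, ∃ s ∈ R, a * c = c * s ∧ a * d = d * s) : ¬ IsFrobeniusAlg F A := by
  rintro ⟨α, hα⟩
  let Φ : (R × R) →ₗ[F] Module.Dual F R :=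
    LinearMap.mk₂ F (fun (q : R × R) (s : R) => α (s.1 * (c * q.1.1 + d * q.2.1)))
      (fun q q' s => by
        rw [← map_add, ← mul_add]
        congr 2
        simp only [Prod.fst_add, Prod.snd_add, Subalgebra.coe_add, mul_add]
        abel)
      (fun r q s => by
        rw [← map_smul, ← mul_smul_comm]
        congr 2
        simp only [Prod.smul_fst, Prod.smul_snd, Subalgebra.coe_smul, mul_smul_comm, smul_add])
      (fun q s s' => by rw [← map_add, ← add_mul]; rfl)
      (fun r q s => by rw [← map_smul, ← smul_mul_assoc]; rfl)
  have hΦ : Function.Injective Φ := by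
    rw [injective_iff_map_eq_zero]
    rintro ⟨r, r'⟩ h
    have h1 : c * r.1 + d * r'.1 = 0 := by
      rw [← (hα _).1]
      intro a
      obtain ⟨s, hs, hsc, hsd⟩ := hact a
      have h2 : a * (c * r.1 + d * r'.1) = s * (c * r.1 + d * r'.1) := by
        rw [mul_add, mul_add, ← mul_assoc, ← mul_assoc, hsc, hsd, ← hc s hs, ← hd s hs, mul_assoc,
          mul_assoc]
      rw [h2]
      exact LinearMap.congr_fun h ⟨s, hs⟩
    obtain ⟨h2, h3⟩ := hfree _ r.2 _ r'.2 h1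
    exact Prod.ext (Subtype.ext h2) (Subtype.ext h3)
  have h1 := LinearMap.finrank_le_finrank_of_injective hΦ
  rw [Module.finrank_prod, Subspace.dual_finrank_eq] at h1
  have h2 : 0 < Module.finrank F R := Module.finrank_pos
  omega

namespace AssocScheme

section Coordinate

variable {F : Type w} [Field F] {n : ℕ} {U : Fin n → Type u} [∀ h, DecidableEq (U h)]

/-- The matrix acting as `B` on the coordinate `h` and as the identity on all other coordinates. -/
def coordMatrix (h : Fin n) (B : Matrix (U h) (U h) F) : Matrix (∀ h, U h) (∀ h, U h) F :=
  piKronecker F U (Function.update (fun _ => 1) h B)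

theorem coordMatrix_zero (h : Fin n) : coordMatrix h (0 : Matrix (U h) (U h) F) = 0 :=
  piKronecker_eq_zero (i := h) (Function.update_self _ _ _)

variable [∀ h, Fintype (U h)]

theorem piKronecker_mul_coordMatrix (m : ∀ h, Matrix (U h) (U h) F) (h : Fin n)
    (B : Matrix (U h) (U h) F) :
    piKronecker F U m * coordMatrix h B = piKronecker F U (Function.update m h (m h * B)) := by
  rw [coordMatrix, piKronecker_mul]
  congr 1
  funext j
  by_cases hj : j = h
  · subst hj; simp
  · simp [hj]

theorem coordMatrix_mul_piKronecker (m : ∀ h, Matrix (U h) (U h) F) (h : Fin n)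
    (B : Matrix (U h) (U h) F) :
    coordMatrix h B * piKronecker F U m = piKronecker F U (Function.update m h (B * m h)) := by
  rw [coordMatrix, piKronecker_mul]
  congr 1
  funext j
  by_cases hj : j = h
  · subst hj; simp
  · simp [hj]

theorem coordMatrix_mul (h : Fin n) (B C : Matrix (U h) (U h) F) :
    coordMatrix h B * coordMatrix h C = coordMatrix h (B * C) := by
  rw [coordMatrix, piKronecker_mul_coordMatrix, Function.update_idem, Function.update_self,
    coordMatrix]

/-- Tensoring with a nonzero matrix at the coordinate `h` is injective on the matrices that commute
with all matrices acting on that coordinate, since the nonzero matrix generates the unit ideal of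
the full matrix algebra. -/
theorem eq_zero_of_coordMatrix_mul_eq_zero {h : Fin n} {B : Matrix (U h) (U h) F} (hB : B ≠ 0)
    {r : Matrix (∀ h, U h) (∀ h, U h) F} (hr : ∀ m, r * coordMatrix h m = coordMatrix h m * r)
    (h0 : coordMatrix h B * r = 0) : r = 0 := by
  obtain ⟨i, j, hij⟩ : ∃ i j, B i j ≠ 0 := by
    by_contra! h2
    exact hB (Matrix.ext h2)
  have h1 : ∀ v, coordMatrix h (Matrix.single v v (B i j)) * r = 0 := fun v => by
    have h2 : Matrix.single v i 1 * B * Matrix.single j v 1 = Matrix.single v v (B i j) := by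
      rw [Matrix.single_mul_mul_single]; simp
    rw [← h2, ← coordMatrix_mul, ← coordMatrix_mul, mul_assoc, ← hr, mul_assoc, ← mul_assoc _ r, h0,
      zero_mul, mul_zero]
  have h2 : coordMatrix h (∑ v, Matrix.single v v (B i j)) * r = 0 := by
    rw [coordMatrix, MultilinearMap.map_update_sum, Finset.sum_mul]
    exact Finset.sum_eq_zero fun v _ => h1 v
  have h3 : ∑ v, Matrix.single v v (B i j) = B i j • (1 : Matrix (U h) (U h) F) := by
    rw [← Matrix.diagonal_one, ← Matrix.sum_single_eq_diagonal, Finset.smul_sum]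
    simp
  rw [h3, coordMatrix, MultilinearMap.map_update_smul, Function.update_eq_self_iff.mpr rfl,
    piKronecker_one, smul_mul_assoc, one_mul] at h2
  exact (smul_eq_zero.mp h2).resolve_left hij

end Coordinate

section Vanishing

variable {F : Type w} [Field F] {n : ℕ} {U : Fin n → Type u} [∀ h, Fintype (U h)]
  [∀ h, DecidableEq (U h)] [∀ h, Nontrivial (U h)] {x : ∀ h, U h} {h : Fin n}

theorem piKronecker_update_mem_terwilliger {m : ∀ j, Matrix (U j) (U j) F}
    (hm : ∀ j, m j ∈ tripleSpan F (x j)) {B : Matrix (U h) (U h) F}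
    (hB : B ∈ tripleSpan F (x h)) :
    piKronecker F U (Function.update m h B) ∈ (factorialScheme U).terwilliger F x := by
  refine piKronecker_mem_terwilliger x _ fun j => ?_
  by_cases hj : j = h
  · subst hj; simpa using hB
  · simpa [hj] using hm j

theorem coordMatrix_mem_terwilliger {B : Matrix (U h) (U h) F} (hB : B ∈ tripleSpan F (x h)) :
    coordMatrix h B ∈ (factorialScheme U).terwilliger F x :=
  piKronecker_update_mem_terwilliger (fun j => one_mem_tripleSpan (x j)) hB

theorem dualIdem_mul_sphereBlock_one {V : Type u} [Fintype V] [DecidableEq V] [Nontrivial V]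
    {y : V} (i j : Fin 2) :
    (trivialScheme V).dualIdem F y i * sphereBlock F y 1 j =
      (if i = 1 then 1 else 0 : F) • sphereBlock F y 1 j := by
  rw [dualIdem_mul_sphereBlock]
  split_ifs <;> simp

theorem adjMatrix_mul_sphereBlock_one {V : Type u} [Fintype V] [DecidableEq V] [Nontrivial V]
    {y : V} (hk : (Fintype.card V : F) - 1 = 0) (i j : Fin 2) :
    (trivialScheme V).adjMatrix F i * sphereBlock F y 1 j =
      (if i = 0 then 1 else -1 : F) • sphereBlock F y 1 j := by
  fin_cases i
  · simp [adjMatrix_zero]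
  · have h1 := congrArg (· * sphereBlock F y 1 j) (one_add_adjMatrix_one (F := F) y)
    simp only [Fin.sum_univ_two, add_mul, sphereBlock_mul, sphereCard, hk] at h1
    change (trivialScheme V).adjMatrix F 1 * _ = _
    simp at h1
    simpa using (eq_neg_of_add_eq_zero_right h1)

theorem sphereBlock_one_mul_adjMatrix {V : Type u} [Fintype V] [DecidableEq V] [Nontrivial V]
    {y : V} (hk : (Fintype.card V : F) - 1 = 0) (i j : Fin 2) :
    sphereBlock F y j 1 * (trivialScheme V).adjMatrix F i =
      (if i = 0 then 1 else -1 : F) • sphereBlock F y j 1 := by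
  fin_cases i
  · simp [adjMatrix_zero]
  · have h1 := congrArg (sphereBlock F y j 1 * ·) (one_add_adjMatrix_one (F := F) y)
    simp only [Fin.sum_univ_two, mul_add, sphereBlock_mul, sphereCard, hk] at h1
    change _ * (trivialScheme V).adjMatrix F 1 = _
    simp at h1
    simpa using (eq_neg_of_add_eq_zero_right h1)

theorem coordMatrix_sphereBlock_mul_self (hk : (Fintype.card (U h) : F) - 1 = 0) :
    coordMatrix h (sphereBlock F (x h) 1 1) * coordMatrix h (sphereBlock F (x h) 1 1) = 0 := by
  rw [coordMatrix_mul, sphereBlock_mul]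
  simp [sphereCard, hk, coordMatrix_zero]

/-- If the valency `|U_h| - 1` vanishes in `F`, then `E_1^* J E_1^*` at the coordinate `h` is
central in the Terwilliger algebra. -/
theorem mul_coordMatrix_sphereBlock_comm (hk : (Fintype.card (U h) : F) - 1 = 0)
    {t : Matrix (∀ h, U h) (∀ h, U h) F} (ht : t ∈ (factorialScheme U).terwilliger F x) :
    t * coordMatrix h (sphereBlock F (x h) 1 1) = coordMatrix h (sphereBlock F (x h) 1 1) * t := by
  induction ht using Algebra.adjoin_induction with
  | mem t ht =>
    rcases ht with ⟨g, rfl⟩ | ⟨g, rfl⟩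
    · rw [adjMatrix_factorialScheme, piKronecker_mul_coordMatrix, coordMatrix_mul_piKronecker,
        adjMatrix_mul_sphereBlock_one hk, sphereBlock_one_mul_adjMatrix hk]
    · rw [dualIdem_factorialScheme, piKronecker_mul_coordMatrix, coordMatrix_mul_piKronecker,
        dualIdem_mul_sphereBlock, sphereBlock_mul_dualIdem]
      simp only [eq_comm]
  | algebraMap r => exact Algebra.commutes _ _
  | add s t _ _ hs ht => rw [add_mul, mul_add, hs, ht]
  | mul s t _ _ hs ht => rw [mul_assoc, ht, ← mul_assoc, hs, mul_assoc]

/-- If the valency `|U_h| - 1` vanishes in `F`, then the generators, hence all elements, of the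
Terwilliger algebra act on `E_1^* J E_0^*` and `E_1^* J E_1^*` at the coordinate `h` through one and
the same element that acts trivially on that coordinate. -/
theorem exists_mul_coordMatrix_sphereBlock (hk : (Fintype.card (U h) : F) - 1 = 0)
    {t : Matrix (∀ h, U h) (∀ h, U h) F} (ht : t ∈ (factorialScheme U).terwilliger F x) :
    ∃ s ∈ (factorialScheme U).terwilliger F x,
      (∀ m, s * coordMatrix h m = coordMatrix h m * s) ∧
      ∀ j, t * coordMatrix h (sphereBlock F (x h) 1 j) =
        coordMatrix h (sphereBlock F (x h) 1 j) * s := by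
  have key : ∀ (m : ∀ j, Matrix (U j) (U j) F) (χ : F), (∀ j, m j ∈ tripleSpan F (x j)) →
      (∀ j, m h * sphereBlock F (x h) 1 j = χ • sphereBlock F (x h) 1 j) →
      ∃ s ∈ (factorialScheme U).terwilliger F x,
        (∀ m, s * coordMatrix h m = coordMatrix h m * s) ∧
        ∀ j, piKronecker F U m * coordMatrix h (sphereBlock F (x h) 1 j) =
          coordMatrix h (sphereBlock F (x h) 1 j) * s := by
    intro m χ hm hχ
    refine ⟨χ • piKronecker F U (Function.update m h 1), Subalgebra.smul_mem _
      (piKronecker_update_mem_terwilliger hm (one_mem_tripleSpan _)) _, fun B => ?_, fun j => ?_⟩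
    · rw [smul_mul_assoc, mul_smul_comm, piKronecker_mul_coordMatrix, coordMatrix_mul_piKronecker,
        Function.update_self, one_mul, mul_one]
    · rw [mul_smul_comm, piKronecker_mul_coordMatrix, coordMatrix_mul_piKronecker, hχ,
        Function.update_self, mul_one, Function.update_idem, MultilinearMap.map_update_smul]
  induction ht using Algebra.adjoin_induction with
  | mem t ht =>
    rcases ht with ⟨g, rfl⟩ | ⟨g, rfl⟩
    · rw [adjMatrix_factorialScheme]
      exact key _ _ (fun j => adjMatrix_mem_tripleSpan (x j) (g j))
        fun j => adjMatrix_mul_sphereBlock_one hk (g h) j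
    · rw [dualIdem_factorialScheme]
      exact key _ _ (fun j => dualIdem_mem_tripleSpan (x j) (g j))
        fun j => dualIdem_mul_sphereBlock_one (g h) j
  | algebraMap r =>
    exact ⟨_, Subalgebra.algebraMap_mem _ r, fun m => Algebra.commutes _ _,
      fun j => Algebra.commutes _ _⟩
  | add t t' _ _ ht ht' =>
    obtain ⟨s, hs, h1, h2⟩ := ht
    obtain ⟨s', hs', h1', h2'⟩ := ht'
    exact ⟨s + s', add_mem hs hs', fun m => by rw [add_mul, mul_add, h1, h1'],
      fun j => by rw [add_mul, mul_add, h2, h2']⟩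
  | mul t t' _ _ ht ht' =>
    obtain ⟨s, hs, h1, h2⟩ := ht
    obtain ⟨s', hs', h1', h2'⟩ := ht'
    exact ⟨s * s', mul_mem hs hs', fun m => by rw [mul_assoc, h1', ← mul_assoc, h1, mul_assoc],
      fun j => by rw [mul_assoc, h2', ← mul_assoc, h2, mul_assoc]⟩

theorem not_isFrobeniusAlg_terwilliger (hk : (Fintype.card (U h) : F) - 1 = 0) :
    ¬ IsFrobeniusAlg F ((factorialScheme U).terwilliger F x) := by
  let B : Fin 2 → Matrix (∀ h, U h) (∀ h, U h) F := fun j => coordMatrix h (sphereBlock F (x h) 1 j)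
  have hB : ∀ j, B j ∈ (factorialScheme U).terwilliger F x := fun j =>
    coordMatrix_mem_terwilliger (sphereBlock_mem_tripleSpan _ _ _)
  let R : Subalgebra F ((factorialScheme U).terwilliger F x) :=
    (Subalgebra.centralizer F (Set.range (coordMatrix (F := F) (U := U) h))).comap
      ((factorialScheme U).terwilliger F x).val
  have hR : ∀ t, t ∈ R ↔ ∀ m, t.1 * coordMatrix h m = coordMatrix h m * t.1 := fun t => by
    change t.1 ∈ Subalgebra.centralizer F _ ↔ _
    rw [Subalgebra.mem_centralizer_iff, Set.forall_mem_range]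
    exact forall_congr' fun m => eq_comm
  refine not_isFrobeniusAlg_of_free_pair R ⟨B 0, hB 0⟩ ⟨B 1, hB 1⟩
    (fun r hr => Subtype.ext ((hR r).mp hr _)) (fun r hr => Subtype.ext ((hR r).mp hr _))
    (fun r hr s hs hrs => ?_) (fun a => ?_)
  · replace hrs : B 0 * r.1 + B 1 * s.1 = 0 := congrArg Subtype.val hrs
    -- right multiplication by `E_0^*` at the coordinate `h` kills the second summand
    have hE : ∀ j, B j * coordMatrix h ((trivialScheme (U h)).dualIdem F (x h) 0) =
        if j = 0 then B j else 0 := fun j => by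
      simp only [B, coordMatrix_mul, sphereBlock_mul_dualIdem]
      split_ifs
      · rfl
      · exact coordMatrix_zero h
    have h1 := congrArg (· * coordMatrix h ((trivialScheme (U h)).dualIdem F (x h) 0)) hrs
    simp only [add_mul, mul_assoc, (hR r).mp hr, (hR s).mp hs, zero_mul] at h1
    rw [← mul_assoc, ← mul_assoc, hE, hE] at h1
    have h2 : B 0 * r.1 = 0 := by simpa using h1
    have h3 : r.1 = 0 :=
      eq_zero_of_coordMatrix_mul_eq_zero (sphereBlock_ne_zero _ _ _) ((hR r).mp hr) h2
    rw [h2, zero_add] at hrs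
    exact ⟨Subtype.ext h3, Subtype.ext
      (eq_zero_of_coordMatrix_mul_eq_zero (sphereBlock_ne_zero _ _ _) ((hR s).mp hs) hrs)⟩
  · obtain ⟨s, hs, h1, h2⟩ := exists_mul_coordMatrix_sphereBlock hk a.2
    exact ⟨⟨s, hs⟩, (hR _).mpr h1, Subtype.ext (h2 0), Subtype.ext (h2 1)⟩

/-- A vanishing valency produces a central element `z` with `z² = 0` that survives in the corner of
`E_1^*`, where `1` is the all-ones tuple. -/
theorem exists_central_sq_zero (hk : (Fintype.card (U h) : F) - 1 = 0) :
    ∃ z : (factorialScheme U).terwilliger F x, (∀ a, a * z = z * a) ∧ z * z = 0 ∧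
      (factorialScheme U).dualIdemT F x (fun _ => 1) * z *
        (factorialScheme U).dualIdemT F x (fun _ => 1) ≠ 0 := by
  refine ⟨⟨_, coordMatrix_mem_terwilliger (sphereBlock_mem_tripleSpan (x h) 1 1)⟩,
    fun a => Subtype.ext (mul_coordMatrix_sphereBlock_comm hk a.2),
    Subtype.ext (coordMatrix_sphereBlock_mul_self hk), fun h0 => ?_⟩
  replace h0 := congrArg Subtype.val h0
  change (factorialScheme U).dualIdem F x (fun _ => 1) *
    coordMatrix h (sphereBlock F (x h) 1 1) * (factorialScheme U).dualIdem F x (fun _ => 1) = 0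
    at h0
  rw [dualIdem_factorialScheme, piKronecker_mul_coordMatrix, piKronecker_mul] at h0
  refine piKronecker_ne_zero (fun j => ?_) h0
  by_cases hj : j = h
  · subst hj
    simp [dualIdem_mul_sphereBlock, sphereBlock_mul_dualIdem, sphereBlock_ne_zero]
  · simpa only [Function.update_of_ne hj, dualIdem_mul_dualIdem, if_true] using
      dualIdem_trivialScheme_ne_zero (x j) 1

theorem dualIdemT_ne_zero (g : Fin n → Fin 2) : (factorialScheme U).dualIdemT F x g ≠ 0 := by
  intro h0
  replace h0 := congrArg Subtype.val h0
  change (factorialScheme U).dualIdem F x g = 0 at h0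
  rw [dualIdem_factorialScheme] at h0
  exact piKronecker_ne_zero (fun j => dualIdem_trivialScheme_ne_zero (x j) (g j)) h0

end Vanishing

theorem not_dvd_prod_card_sub_one_iff (F : Type w) [Field F] (p : ℕ) [CharP F p] {n : ℕ}
    (U : Fin n → Type u) [∀ h, Fintype (U h)] [∀ h, Nontrivial (U h)] :
    ¬ p ∣ ∏ h, (Fintype.card (U h) - 1) ↔ ∀ h, (Fintype.card (U h) : F) - 1 ≠ 0 := by
  rw [← CharP.cast_eq_zero_iff F p, Nat.cast_prod, ← ne_eq, Finset.prod_ne_zero_iff]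
  simp only [Nat.cast_sub Fintype.card_pos, Nat.cast_one, Finset.mem_univ, true_implies]

theorem isPrimeValenced_factorialScheme_iff (F : Type w) [Field F] (p : ℕ) [CharP F p] {n : ℕ}
    (U : Fin n → Type u) [∀ h, Fintype (U h)] [∀ h, DecidableEq (U h)] [∀ h, Nontrivial (U h)] :
    (factorialScheme U).IsPrimeValenced p ↔ ∀ h, (Fintype.card (U h) : F) - 1 ≠ 0 := by
  have hcast : ∀ h, ((Fintype.card (U h) - 1 : ℕ) : F) = (Fintype.card (U h) : F) - 1 := fun h => by
    rw [Nat.cast_sub Fintype.card_pos, Nat.cast_one]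
  constructor
  · intro h j
    have h1 := h fun i => if i = j then 1 else 0
    rw [valency_factorialScheme, ← CharP.cast_eq_zero_iff F p, Nat.cast_prod,
      Finset.prod_eq_single j] at h1
    · simpa [hcast] using h1
    · intro i _ hi; simp [hi]
    · simp
  · intro h g
    rw [valency_factorialScheme, ← CharP.cast_eq_zero_iff F p, Nat.cast_prod, ← ne_eq,
      Finset.prod_ne_zero_iff]
    intro j _
    split_ifs
    · simp
    · rw [hcast]; exact h j

end AssocScheme

theorem theorem8p18 (F : Type w) [Field F] (p : ℕ) [CharP F p] (n : ℕ) (hn : 1 ≤ n)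
    (U : Fin n → Type u) [∀ h, Fintype (U h)] [∀ h, DecidableEq (U h)] [∀ h, Nontrivial (U h)]
    (x : ∀ h, U h) :
    List.TFAE [
      (AssocScheme.factorialScheme U).IsPrimeValenced p,
      IsSemisimpleAlg F ((AssocScheme.factorialScheme U).terwilliger F x),
      ∀ g : Fin n → Fin 2, IsSemisimpleAlg F
        ((AssocScheme.factorialScheme U).isIdempotentElem_dualIdemT F x g).Corner,
      IsSemisimpleAlg F
        ((AssocScheme.factorialScheme U).isIdempotentElem_dualIdemT F x fun _ => 1).Corner,
      IsSemisimpleAlg F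
        (Subalgebra.center F ((AssocScheme.factorialScheme U).terwilliger F x)),
      IsSymmetricAlg F ((AssocScheme.factorialScheme U).terwilliger F x),
      IsFrobeniusAlg F ((AssocScheme.factorialScheme U).terwilliger F x),
      Nonempty ((AssocScheme.factorialScheme U).terwilliger F x ≃ₐ[F]
        ∀ m : Quotient (FactorialScheme.relD U p),
          Matrix (Fin (FactorialScheme.classD U p m).ncard)
            (Fin (FactorialScheme.classD U p m).ncard) F),
      ¬ p ∣ ∏ h, (Fintype.card (U h) - 1)] := by
  have hprod := AssocScheme.not_dvd_prod_card_sub_one_iff F p U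
  have hval := AssocScheme.isPrimeValenced_factorialScheme_iff F p U
  tfae_have 1 ↔ 9 := hval.trans hprod.symm
  tfae_have 9 → 8 := fun h =>
    AssocScheme.nonempty_terwilliger_algEquiv (hprod.mp h) (hval.mpr (hprod.mp h))
  tfae_have 8 → 2 := by
    rintro ⟨φ⟩
    refine isSemisimpleAlg_of_semiprime fun z hz => φ.injective ?_
    rw [map_zero]
    refine eq_zero_of_mul_mul_self_pi_matrix _ fun a => ?_
    rw [← φ.apply_symm_apply a, ← map_mul, ← map_mul, hz, map_zero]
  tfae_have 2 → 3 := fun h g => h.corner _ (AssocScheme.dualIdemT_ne_zero g)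
  tfae_have 3 → 4 := fun h => h _
  tfae_have 4 → 9 := fun h => hprod.mpr fun j hj => by
    obtain ⟨z, hc, hz, h0⟩ := AssocScheme.exists_central_sq_zero (x := x) hj
    exact not_isSemisimpleAlg_corner _ hc hz h0 h
  tfae_have 2 → 5 := fun h => h.center
  tfae_have 5 → 9 := fun h => hprod.mpr fun j hj => by
    obtain ⟨z, hc, hz, h0⟩ := AssocScheme.exists_central_sq_zero (x := x) hj
    have h1 : (⟨z, Subalgebra.mem_center_iff.mpr hc⟩ :
        Subalgebra.center F ((AssocScheme.factorialScheme U).terwilliger F x)) = 0 :=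
      h.eq_zero_of_mul_mul_self fun a => Subtype.ext (by
        change z * a.1 * z = 0
        rw [mul_assoc, hc, ← mul_assoc, hz, zero_mul])
    have h2 : z = 0 := congrArg Subtype.val h1
    exact h0 (by rw [h2]; simp)
  tfae_have 8 → 6 := by
    rintro ⟨φ⟩
    have := Fintype.ofFinite (Quotient (FactorialScheme.relD U p))
    exact (isSymmetricAlg_pi_matrix F).of_algEquiv φ
  tfae_have 6 → 7 := fun ⟨α, hα, _⟩ => ⟨α, hα⟩
  tfae_have 7 → 9 := fun h => hprod.mpr fun j hj =>
    AssocScheme.not_isFrobeniusAlg_terwilliger hj h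
  tfae_finish
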